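/- For a nonempty bounded open set $\Omega\subset\mathbb R^N$ ($N\ge 1$) let $H_0^1(\Omega)$ be the closure of $C_c^\infty(\Omega)$ in $H^1(\Omega)$ (real-valued functions), with the inner product $[u,v]_\nabla=\int_\Omega\nabla u\cdot\nabla v\,dx$. A real number $\lambda$ is a Dirichlet Laplacian eigenvalue of $\Omega$, with eigenfunction $u$, if $0\ne u\in H_0^1(\Omega)$ and $\int_\Omega\nabla u\cdot\nabla h\,dx=\lambda\int_\Omega u\,h\,dx$ for all $h\in H_0^1(\Omega)$. Let $\Omega_1\subset\mathbb R^{N_1}$ and $\Omega_2\subset\mathbb R^{N_2}$ ($N_1,N_2\ge1$) be nonempty, bounded and open. For $i=1,2$ let $(\lambda_{ij})_{j\in\mathbb N}$ be the sequence of all Dirichlet Laplacian eigenvalues of $\Omega_i$, repeated according to multiplicity, and let $(e_{ij})_{j\in\mathbb N}$ be an associated $L^2(\Omega_i)$-orthonormal sequence of eigenfunctions, so that for each eigenvalue $\mu$ of $\Omega_i$ the $e_{ij}$ with $\lambda_{ij}=\mu$ span its eigenspace. For functions $u$ on $\Omega_1$ and $v$ on $\Omega_2$ write $(u\otimes v)(x,y)=u(x)v(y)$.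 Then: 1. A real number $\mu$ is a Dirichlet Laplacian eigenvalue of $\Omega_1\times\Omega_2$ if and only if $\mu=\lambda_{1j}+\lambda_{2k}$ for some $j,k\in\mathbb N$. 2. $H_0^1(\Omega_1\times\Omega_2)$ is the Hilbert tensor product of $H_0^1(\Omega_1)$ and $H_0^1(\Omega_2)$ in the following sense. For all $u\in H_0^1(\Omega_1)$ and $v\in H_0^1(\Omega_2)$ the function $u\otimes v$ belongs to $H_0^1(\Omega_1\times\Omega_2)$, and the finite linear combinations of such functions are dense in $H_0^1(\Omega_1\times\Omega_2)$. Moreover, there is an isometric linear isomorphism $\Phi$ from the Hilbert tensor product $H_0^1(\Omega_1)\otimes H_0^1(\Omega_2)$ (the completion of the algebraic tensor product for the inner product determined by $\langle a\otimes b,c\otimes d\rangle=[a,c]_\nabla[b,d]_\nabla$) onto $H_0^1(\Omega_1\times\Omega_2)$ such that, for all $j,k\in\mathbb N$, $$\Phi\bigl(\lambda_{1j}^{-1/2}e_{1j}\otimes\lambda_{2k}^{-1/2}e_{2k}\bigr)=(\lambda_{1j}+\lambda_{2k})^{-1/2}\,u_{jk},$$ where $u_{jk}(x,y)=e_{1j}(x)e_{2k}(y)$.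 -/

import Mathlib

open MeasureTheory Set
open scoped ContDiff TensorProduct

noncomputable section

namespace ProductDirichlet

/-- A nonempty bounded open subset of `ℝ^ι`. (Only the topology, boundedness and Lebesgue measure
of `ℝ^ι` are ever used, so the choice of a norm on `ι → ℝ` plays no role.) -/
structure Domain (ι : Type) [Fintype ι] where
  carrier : Set (ι → ℝ)
  isOpen : IsOpen carrier
  isBounded : Bornology.IsBounded carrier
  nonempty : carrier.Nonempty

variable {ι κ : Type} [Fintype ι] [Fintype κ]

/-- The real Hilbert space `L²(Ω)` for Lebesgue measure on `Ω`. -/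
abbrev L2 (Ω : Domain ι) : Type := Lp ℝ 2 (volume.restrict Ω.carrier)

open Classical in
/-- The classical partial derivative `∂φ/∂xᵢ`. -/
def pderiv (φ : (ι → ℝ) → ℝ) (i : ι) (x : ι → ℝ) : ℝ :=
  fderiv ℝ φ x (Pi.single i 1)

/-- `φ ∈ C_c^∞(Ω)`. -/
structure IsTestFunction (Ω : Domain ι) (φ : (ι → ℝ) → ℝ) : Prop where
  smooth : ContDiff ℝ ∞ φ
  compact : HasCompactSupport φ
  subset : tsupport φ ⊆ Ω.carrier

section Test

variable {Ω : Domain ι}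

lemma pderiv_add {φ ψ : (ι → ℝ) → ℝ} (hφ : ContDiff ℝ ∞ φ) (hψ : ContDiff ℝ ∞ ψ) (i : ι)
    (x : ι → ℝ) : pderiv (φ + ψ) i x = pderiv φ i x + pderiv ψ i x := by
  have h1 : DifferentiableAt ℝ φ x := (hφ.differentiable (by simp)) x
  have h2 : DifferentiableAt ℝ ψ x := (hψ.differentiable (by simp)) x
  simp [pderiv, fderiv_add h1 h2]

lemma pderiv_smul {φ : (ι → ℝ) → ℝ} (hφ : ContDiff ℝ ∞ φ) (c : ℝ) (i : ι)
    (x : ι → ℝ) : pderiv (c • φ) i x = c * pderiv φ i x := by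
  have h1 : DifferentiableAt ℝ φ x := (hφ.differentiable (by simp)) x
  simp [pderiv, fderiv_const_smul h1]

lemma IsTestFunction.add {φ ψ : (ι → ℝ) → ℝ} (hφ : IsTestFunction Ω φ)
    (hψ : IsTestFunction Ω ψ) : IsTestFunction Ω (φ + ψ) where
  smooth := hφ.smooth.add hψ.smooth
  compact := hφ.compact.add hψ.compact
  subset := (tsupport_add φ ψ).trans (union_subset hφ.subset hψ.subset)

lemma IsTestFunction.smul {φ : (ι → ℝ) → ℝ} (hφ : IsTestFunction Ω φ) (c : ℝ) :
    IsTestFunction Ω (c • φ) where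
  smooth := hφ.smooth.const_smul c
  compact := hφ.compact.smul_left (f := fun _ => c)
  subset := (tsupport_smul_subset_right (fun _ => c) φ).trans hφ.subset

end Test

/-- The space of pairs `(φ, ∇φ)` with `φ ∈ C_c^∞(Ω)`, as a subspace of `L²(Ω) × L²(Ω)^ι`. -/
def testGraph (Ω : Domain ι) : Submodule ℝ (L2 Ω × (ι → L2 Ω)) :=
  { carrier := {p | ∃ φ : (ι → ℝ) → ℝ, IsTestFunction Ω φ ∧
      p.1 =ᵐ[volume.restrict Ω.carrier] φ ∧
      ∀ i, p.2 i =ᵐ[volume.restrict Ω.carrier] pderiv φ i}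
    add_mem' := by
      rintro p q ⟨φ, hφ, hp, hp'⟩ ⟨ψ, hψ, hq, hq'⟩
      refine ⟨φ + ψ, hφ.add hψ, ?_, fun i => ?_⟩
      · filter_upwards [Lp.coeFn_add p.1 q.1, hp, hq] with x h1 h2 h3
        exact h1.trans (by simp [h2, h3])
      · filter_upwards [Lp.coeFn_add (p.2 i) (q.2 i), hp' i, hq' i] with x h1 h2 h3
        exact h1.trans (by simp [h2, h3, pderiv_add hφ.smooth hψ.smooth])
    zero_mem' := by
      refine ⟨0, ⟨contDiff_const, HasCompactSupport.zero, by simp [tsupport]⟩, ?_, fun i => ?_⟩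
      · exact Lp.coeFn_zero _ _ _
      · filter_upwards [Lp.coeFn_zero ℝ 2 (volume.restrict Ω.carrier)] with x h1
        simpa [pderiv] using h1
    smul_mem' := by
      rintro c p ⟨φ, hφ, hp, hp'⟩
      refine ⟨c • φ, hφ.smul c, ?_, fun i => ?_⟩
      · filter_upwards [Lp.coeFn_smul c p.1, hp] with x h1 h2
        exact h1.trans (by simp [h2])
      · filter_upwards [Lp.coeFn_smul c (p.2 i), hp' i] with x h1 h2
        exact h1.trans (by simp [h2, pderiv_smul hφ.smooth]) }

/-- The Sobolev space `H₀¹(Ω)`: the closure of `C_c^∞(Ω)` in the `H¹(Ω)`-norm. An element is a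
function `u ∈ L²(Ω)` together with its (unique) weak gradient. It is a separate type because it
carries the Dirichlet inner product below and not the norm of `L²(Ω) × L²(Ω)^ι`. -/
def H01 (Ω : Domain ι) : Type := ↥(testGraph Ω).topologicalClosure

namespace H01

variable {Ω : Domain ι}

instance : AddCommGroup (H01 Ω) := inferInstanceAs (AddCommGroup ↥(testGraph Ω).topologicalClosure)

instance : Module ℝ (H01 Ω) := inferInstanceAs (Module ℝ ↥(testGraph Ω).topologicalClosure)

/-- The inclusion `H₀¹(Ω) → L²(Ω)`. -/
def toL2 : H01 Ω →ₗ[ℝ] L2 Ω :=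
  (LinearMap.fst ℝ (L2 Ω) (ι → L2 Ω)).comp (testGraph Ω).topologicalClosure.subtype

/-- The `i`-th weak partial derivative `Dᵢ : H₀¹(Ω) → L²(Ω)`. -/
def wderiv (i : ι) : H01 Ω →ₗ[ℝ] L2 Ω :=
  ((LinearMap.proj i).comp (LinearMap.snd ℝ (L2 Ω) (ι → L2 Ω))).comp
    (testGraph Ω).topologicalClosure.subtype

/-- The `L²` inner product `∫_Ω u v dx`. -/
def l2Inner (u v : H01 Ω) : ℝ := ∫ x in Ω.carrier, u.toL2 x * v.toL2 x

/-- The Dirichlet inner product `∫_Ω ∇u · ∇v dx`. -/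
def gradInner (u v : H01 Ω) : ℝ := ∑ i, ∫ x in Ω.carrier, u.wderiv i x * v.wderiv i x

lemma gradInner_eq (u v : H01 Ω) :
    gradInner u v = ∑ i, inner ℝ (u.wderiv i) (v.wderiv i) := by
  simp [gradInner, L2.inner_def, mul_comm]

end H01

/-- Integration by parts for two smooth functions, one of which has compact support. -/
lemma integral_mul_pderiv {f g : (ι → ℝ) → ℝ} (hf : ContDiff ℝ ∞ f)
    (hg : ContDiff ℝ ∞ g) (hc : HasCompactSupport f) (i : ι) :
    ∫ x, f x * pderiv g i x = - ∫ x, pderiv f i x * g x := by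
  have cf : Continuous fun x => pderiv f i x :=
    (hf.continuous_fderiv (by simp)).clm_apply continuous_const
  have cg : Continuous fun x => pderiv g i x :=
    (hg.continuous_fderiv (by simp)).clm_apply continuous_const
  have hcf : HasCompactSupport fun x => pderiv f i x := hc.fderiv_apply ℝ _
  exact integral_mul_fderiv_eq_neg_fderiv_mul_of_integrable
    ((cf.mul hg.continuous).integrable_of_hasCompactSupport hcf.mul_right)
    ((hf.continuous.mul cg).integrable_of_hasCompactSupport hc.mul_right)
    ((hf.continuous.mul hg.continuous).integrable_of_hasCompactSupport hc.mul_right)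
    (fun x _ => (hf.differentiable (by simp)) x) (fun x _ => (hg.differentiable (by simp)) x)

/-- The one-directional Poincaré inequality for test functions. -/
lemma poincare_test (Ω : Domain ι) {R : ℝ}
    (hR : ∀ x ∈ Ω.carrier, ‖x‖ ≤ R) {φ : (ι → ℝ) → ℝ} (hφ : IsTestFunction Ω φ) (i : ι) :
    ∫ x in Ω.carrier, φ x * φ x ≤ 4 * R ^ 2 * ∫ x in Ω.carrier, pderiv φ i x * pderiv φ i x := by
  have hsm := hφ.smooth
  have cφ : Continuous φ := hsm.continuous
  have cd : Continuous fun x => pderiv φ i x :=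
    (hsm.continuous_fderiv (by simp)).clm_apply continuous_const
  have hcd : HasCompactSupport fun x => pderiv φ i x := hφ.compact.fderiv_apply ℝ _
  have hdS : tsupport (fun x => pderiv φ i x) ⊆ Ω.carrier :=
    (tsupport_fderiv_apply_subset ℝ _).trans hφ.subset
  have e0 : ∀ x, x ∉ Ω.carrier → φ x = 0 := fun x hx =>
    image_eq_zero_of_notMem_tsupport (fun h => hx (hφ.subset h))
  have e1 : ∀ x, x ∉ Ω.carrier → pderiv φ i x = 0 := fun x hx =>
    image_eq_zero_of_notMem_tsupport (f := fun x => pderiv φ i x) (fun h => hx (hdS h))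
  rw [setIntegral_eq_integral_of_forall_compl_eq_zero (fun x hx => by simp [e0 x hx]),
    setIntegral_eq_integral_of_forall_compl_eq_zero (fun x hx => by simp [e1 x hx])]
  have hcoord : ContDiff ℝ ∞ (fun x : ι → ℝ => x i) := contDiff_apply ℝ ℝ i
  have key := integral_mul_pderiv (f := fun x => φ x * φ x) (g := fun x => x i)
    (hsm.mul hsm) hcoord hφ.compact.mul_right i
  have hg1 : ∀ x : ι → ℝ, pderiv (fun x : ι → ℝ => x i) i x = 1 := by
    intro x
    have : fderiv ℝ (fun x : ι → ℝ => x i) x = ContinuousLinearMap.proj i :=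
      (ContinuousLinearMap.proj (R := ℝ) (φ := fun _ : ι => ℝ) i).fderiv
    simp [pderiv, this]
  have hg2 : ∀ x : ι → ℝ, pderiv (fun x => φ x * φ x) i x = 2 * φ x * pderiv φ i x := by
    intro x
    have h1 : DifferentiableAt ℝ φ x := (hsm.differentiable (by simp)) x
    simp only [pderiv]
    rw [fderiv_fun_mul h1 h1]
    simp
    ring
  simp only [hg1, hg2, mul_one] at key
  have i1 : Integrable fun x => φ x * φ x :=
    (cφ.mul cφ).integrable_of_hasCompactSupport hφ.compact.mul_right
  have i2 : Integrable fun x => pderiv φ i x * pderiv φ i x :=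
    (cd.mul cd).integrable_of_hasCompactSupport hcd.mul_right
  have i3 : Integrable fun x => -(2 * φ x * pderiv φ i x * x i) := by
    refine Integrable.neg (Continuous.integrable_of_hasCompactSupport ?_ ?_)
    · exact ((continuous_const.mul cφ).mul cd).mul (continuous_apply i)
    · exact (hcd.mul_left (f := fun x => 2 * φ x)).mul_right
  have le : ∫ x, -(2 * φ x * pderiv φ i x * x i) ≤
      ∫ x, ((1 / 2 : ℝ) * (φ x * φ x) + (2 * R ^ 2) * (pderiv φ i x * pderiv φ i x)) := by
    refine integral_mono i3 ((i1.const_mul _).add (i2.const_mul _)) fun x => ?_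
    by_cases hx : x ∈ Ω.carrier
    · have hb : |x i| ≤ R := (norm_le_pi_norm x i).trans (hR x hx)
      have hb2 : (x i) ^ 2 ≤ R ^ 2 := by
        rw [← sq_abs]; exact pow_le_pow_left₀ (abs_nonneg _) hb 2
      have := mul_le_mul_of_nonneg_right hb2 (sq_nonneg (pderiv φ i x))
      simp only
      nlinarith [sq_nonneg (φ x + 2 * (x i * pderiv φ i x))]
    · simp [e0 x hx, e1 x hx]
  rw [integral_neg, ← key, integral_add (i1.const_mul _) (i2.const_mul _), integral_const_mul,
    integral_const_mul] at le
  linarith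

namespace H01

variable {Ω : Domain ι}

/-- The Poincaré inequality on `H₀¹(Ω)`. -/
lemma poincare (Ω : Domain ι) : ∃ C : ℝ, 0 ≤ C ∧ ∀ (u : H01 Ω) (i : ι),
    ‖u.toL2‖ ≤ C * ‖u.wderiv i‖ := by
  classical
  obtain ⟨R, hR⟩ := Ω.isBounded.exists_norm_le
  have hR0 : 0 ≤ R := (norm_nonneg _).trans (hR _ Ω.nonempty.some_mem)
  refine ⟨2 * R, by positivity, fun u i => ?_⟩
  have hcl : IsClosed {p : L2 Ω × (ι → L2 Ω) | ‖p.1‖ ≤ 2 * R * ‖p.2 i‖} :=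
    isClosed_le (by fun_prop) (by fun_prop)
  have hsub : (testGraph Ω : Set (L2 Ω × (ι → L2 Ω))) ⊆ {p | ‖p.1‖ ≤ 2 * R * ‖p.2 i‖} := by
    rintro p ⟨φ, hφ, hp, hp'⟩
    have h1 : ‖p.1‖ ^ 2 = ∫ x in Ω.carrier, φ x * φ x := by
      rw [← real_inner_self_eq_norm_sq, L2.inner_def]
      exact integral_congr_ae (by filter_upwards [hp] with x hx; simp [hx, sq])
    have h2 : ‖p.2 i‖ ^ 2 = ∫ x in Ω.carrier, pderiv φ i x * pderiv φ i x := by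
      rw [← real_inner_self_eq_norm_sq, L2.inner_def]
      exact integral_congr_ae (by filter_upwards [hp' i] with x hx; simp [hx, sq])
    have := poincare_test Ω hR hφ i
    rw [← h1, ← h2] at this
    exact abs_le_of_sq_le_sq' (a := ‖p.1‖) (by nlinarith) (by positivity) |>.2
  exact (closure_minimal hsub hcl) u.2

/-- The components `wderiv i u` are the weak partial derivatives of `u` on `Ω`. -/
lemma integral_toL2_mul_pderiv (u : H01 Ω) (i : ι) {ψ : (ι → ℝ) → ℝ} (hψ : IsTestFunction Ω ψ) :
    ∫ x in Ω.carrier, u.toL2 x * pderiv ψ i x = - ∫ x in Ω.carrier, u.wderiv i x * ψ x := by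
  have cd : Continuous fun x => pderiv ψ i x :=
    (hψ.smooth.continuous_fderiv (by simp)).clm_apply continuous_const
  have hcd : HasCompactSupport fun x => pderiv ψ i x := hψ.compact.fderiv_apply ℝ _
  have m0 : MemLp ψ 2 (volume.restrict Ω.carrier) :=
    (hψ.smooth.continuous.memLp_of_hasCompactSupport hψ.compact).restrict _
  have m1 : MemLp (fun x => pderiv ψ i x) 2 (volume.restrict Ω.carrier) :=
    (cd.memLp_of_hasCompactSupport hcd).restrict _
  have r0 : ∀ f : L2 Ω, inner ℝ f (m0.toLp _) = ∫ x in Ω.carrier, f x * ψ x := fun f => by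
    rw [L2.inner_def]
    exact integral_congr_ae (by filter_upwards [m0.coeFn_toLp] with x hx; simp [hx, mul_comm])
  have r1 : ∀ f : L2 Ω, inner ℝ f (m1.toLp _) = ∫ x in Ω.carrier, f x * pderiv ψ i x := fun f => by
    rw [L2.inner_def]
    exact integral_congr_ae (by filter_upwards [m1.coeFn_toLp] with x hx; simp [hx, mul_comm])
  have hcl : IsClosed {p : L2 Ω × (ι → L2 Ω) |
      inner ℝ p.1 (m1.toLp _) = - inner ℝ (p.2 i) (m0.toLp _)} :=
    isClosed_eq (by fun_prop) (by fun_prop)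
  have hsub : (testGraph Ω : Set (L2 Ω × (ι → L2 Ω))) ⊆
      {p | inner ℝ p.1 (m1.toLp _) = - inner ℝ (p.2 i) (m0.toLp _)} := by
    rintro p ⟨φ, hφ, hp, hp'⟩
    have e0 : ∀ x, x ∉ Ω.carrier → ψ x = 0 := fun x hx =>
      image_eq_zero_of_notMem_tsupport (fun h => hx (hψ.subset h))
    have e1 : ∀ x, x ∉ Ω.carrier → φ x = 0 := fun x hx =>
      image_eq_zero_of_notMem_tsupport (fun h => hx (hφ.subset h))
    have a1 : ∫ x in Ω.carrier, p.1 x * pderiv ψ i x = ∫ x, φ x * pderiv ψ i x := by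
      rw [← setIntegral_eq_integral_of_forall_compl_eq_zero (s := Ω.carrier)
        (f := fun x => φ x * pderiv ψ i x) (fun x hx => by simp [e1 x hx])]
      exact integral_congr_ae (by filter_upwards [hp] with x hx; simp [hx])
    have a2 : ∫ x in Ω.carrier, p.2 i x * ψ x = ∫ x, pderiv φ i x * ψ x := by
      rw [← setIntegral_eq_integral_of_forall_compl_eq_zero (s := Ω.carrier)
        (f := fun x => pderiv φ i x * ψ x) (fun x hx => by simp [e0 x hx])]
      exact integral_congr_ae (by filter_upwards [hp' i] with x hx; simp [hx])
    simp only [mem_ofPred_eq, r0, r1, a1, a2]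
    exact integral_mul_pderiv hφ.smooth hψ.smooth hφ.compact i
  have := (closure_minimal hsub hcl) u.2
  simp only [mem_ofPred_eq, r0, r1] at this
  exact this

instance [Nonempty ι] : InnerProductSpace.Core ℝ (H01 Ω) where
  inner := gradInner
  conj_inner_symm u v := by simp [gradInner, mul_comm]
  re_inner_nonneg u := by
    simp only [gradInner_eq, RCLike.re_to_real]
    exact Finset.sum_nonneg fun i _ => real_inner_self_nonneg
  add_left u v w := by
    simp [gradInner_eq, inner_add_left, Finset.sum_add_distrib]
  smul_left u v r := by
    simp [gradInner_eq, inner_smul_left, Finset.mul_sum]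
  definite u hu := by
    obtain ⟨C, -, hC⟩ := poincare Ω
    have h0 : ∀ i, u.wderiv i = 0 := by
      have hu' : ∑ i, inner ℝ (u.wderiv i) (u.wderiv i) = 0 := by rw [← gradInner_eq]; exact hu
      intro i
      have := (Finset.sum_eq_zero_iff_of_nonneg fun i _ => real_inner_self_nonneg).1 hu' i
        (Finset.mem_univ i)
      exact inner_self_eq_zero.1 this
    have h1 : u.toL2 = 0 := by
      have := hC u (Classical.arbitrary ι)
      rw [h0, norm_zero, mul_zero] at this
      exact norm_le_zero_iff.1 this
    exact Subtype.ext (Prod.ext h1 (funext h0))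

instance [Nonempty ι] : NormedAddCommGroup (H01 Ω) :=
  InnerProductSpace.Core.toNormedAddCommGroup (𝕜 := ℝ)

/-- `H₀¹(Ω)` with the inner product `∫_Ω ∇u · ∇v dx`. -/
instance [Nonempty ι] : InnerProductSpace ℝ (H01 Ω) := InnerProductSpace.ofCore _

end H01

open H01

/-- `u` is a Dirichlet Laplacian eigenfunction with eigenvalue `μ`: it is nonzero and
`∫_Ω ∇u · ∇h dx = μ ∫_Ω u h dx` for all `h ∈ H₀¹(Ω)`. -/
def IsDirichletEigenpair (Ω : Domain ι) (μ : ℝ) (u : H01 Ω) : Prop :=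
  u ≠ 0 ∧ ∀ h : H01 Ω, gradInner u h = μ * l2Inner u h

/-- `μ` is an eigenvalue of the Dirichlet Laplacian on `Ω`. -/
def IsDirichletEigenvalue (Ω : Domain ι) (μ : ℝ) : Prop :=
  ∃ u : H01 Ω, IsDirichletEigenpair Ω μ u

/-- `(lam j)` is the sequence of all Dirichlet Laplacian eigenvalues of `Ω`, repeated according to
multiplicity, and `(e j)` an associated `L²(Ω)`-orthonormal sequence of eigenfunctions: those `e j`
with `lam j = μ` span the eigenspace of each eigenvalue `μ`. -/
structure IsDirichletEigensystem (Ω : Domain ι) (lam : ℕ → ℝ) (e : ℕ → H01 Ω) : Prop where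
  eigenpair : ∀ j, IsDirichletEigenpair Ω (lam j) (e j)
  orthonormal : ∀ j k, l2Inner (e j) (e k) = if j = k then 1 else 0
  complete : ∀ (μ : ℝ) (u : H01 Ω), IsDirichletEigenpair Ω μ u →
    u ∈ Submodule.span ℝ (e '' {j | lam j = μ})

/-- The product domain `Ω₁ × Ω₂` in `ℝ^ι × ℝ^κ = ℝ^(ι ⊕ κ)`; a point `z` is the pair
`(z ∘ Sum.inl, z ∘ Sum.inr)`. -/
def Domain.prod (Ω₁ : Domain ι) (Ω₂ : Domain κ) : Domain (ι ⊕ κ) where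
  carrier := {z | z ∘ Sum.inl ∈ Ω₁.carrier ∧ z ∘ Sum.inr ∈ Ω₂.carrier}
  isOpen := by
    refine (Ω₁.isOpen.preimage (f := fun z : ι ⊕ κ → ℝ => z ∘ Sum.inl) ?_).inter
      (Ω₂.isOpen.preimage (f := fun z : ι ⊕ κ → ℝ => z ∘ Sum.inr) ?_)
    · exact continuous_pi fun i => continuous_apply _
    · exact continuous_pi fun i => continuous_apply _
  isBounded := by
    obtain ⟨R₁, h₁⟩ := Ω₁.isBounded.exists_norm_le
    obtain ⟨R₂, h₂⟩ := Ω₂.isBounded.exists_norm_le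
    refine isBounded_iff_forall_norm_le.2 ⟨max R₁ R₂, ?_⟩
    rintro z ⟨hz₁, hz₂⟩
    have hR : 0 ≤ max R₁ R₂ := (norm_nonneg _).trans ((h₁ _ hz₁).trans (le_max_left _ _))
    refine (pi_norm_le_iff_of_nonneg hR).2 ?_
    rintro (i | k)
    · exact (norm_le_pi_norm (z ∘ Sum.inl) i).trans ((h₁ _ hz₁).trans (le_max_left _ _))
    · exact (norm_le_pi_norm (z ∘ Sum.inr) k).trans ((h₂ _ hz₂).trans (le_max_right _ _))
  nonempty := by
    obtain ⟨x, hx⟩ := Ω₁.nonempty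
    obtain ⟨y, hy⟩ := Ω₂.nonempty
    exact ⟨Sum.elim x y, by simpa using hx, by simpa using hy⟩

/-- `w ∈ H₀¹(Ω₁ × Ω₂)` is the dyad `u ⊗ v`: `w(x, y) = u(x) v(y)` for a.e. `(x, y)`. -/
def IsDyad {Ω₁ : Domain ι} {Ω₂ : Domain κ} (u : H01 Ω₁) (v : H01 Ω₂) (w : H01 (Ω₁.prod Ω₂)) :
    Prop :=
  w.toL2 =ᵐ[volume.restrict (Ω₁.prod Ω₂).carrier]
    fun z => u.toL2 (z ∘ Sum.inl) * v.toL2 (z ∘ Sum.inr)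

/-- The Hilbert tensor product: the completion of the algebraic tensor product for the inner
product with `⟪a ⊗ b, c ⊗ d⟫ = ⟪a, c⟫ ⟪b, d⟫`. -/
abbrev HilbertTensor (E F : Type) [NormedAddCommGroup E] [InnerProductSpace ℝ E]
    [NormedAddCommGroup F] [InnerProductSpace ℝ F] : Type :=
  UniformSpace.Completion (E ⊗[ℝ] F)

/-- The pure tensor `a ⊗ b` in the Hilbert tensor product. -/
def pureTensor {E F : Type} [NormedAddCommGroup E] [InnerProductSpace ℝ E]
    [NormedAddCommGroup F] [InnerProductSpace ℝ F] (a : E) (b : F) : HilbertTensor E F :=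
  ((a ⊗ₜ[ℝ] b : E ⊗[ℝ] F) : UniformSpace.Completion (E ⊗[ℝ] F))

end ProductDirichlet

end

open ProductDirichlet

/-!
Separation of variables. If `e₁`, `e₂` are Dirichlet eigenfunctions of `Ω₁`, `Ω₂` with eigenvalues
`λ₁`, `λ₂`, then `e₁ ⊗ e₂` is one of `Ω₁ × Ω₂` with eigenvalue `λ₁ + λ₂`
(`IsDirichletEigenpair.tensor`): it lies in `H₀¹(Ω₁ × Ω₂)` because `⊗` is continuous for the graph
norms and maps pairs of test functions to test functions, and the weak equation only has to be
tested with `θ ∈ C_c^∞(Ω₁ × Ω₂)`, whose slices in either variable are test functions, so that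
Fubini's theorem reduces it to the two equations on the factors.

All the rest is completeness. The inclusion `J : H₀¹(Ω) → L²(Ω)` is compact
(`isCompactOperator_toL2L`): on a grid of cubes of side `ε`, a test function differs from its cell
averages by at most a multiple of `ε ‖∇φ‖` in `L²`, so `J` is a limit of operators of finite rank.
Hence the spectral theorem for `J*J` shows that the eigenfunctions `e_j` span a dense subspace of
`H₀¹(Ω)` (`IsDirichletEigensystem.orthogonal_span_eq_bot`), and so are complete in `L²(Ω)`. Tensor
products of complete families are complete in `L²(Ω₁ × Ω₂)`. Since an eigenfunction satisfies
`[e, w]_∇ = λ (e, w)_{L²}` with `λ > 0`, a function of `H₀¹(Ω₁ × Ω₂)` orthogonal to all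
`e₁ⱼ ⊗ e₂ₖ` for either inner product vanishes (`eq_zero_of_forall_l2Inner_tensor`). This gives the
list of eigenvalues, because eigenfunctions with different eigenvalues are orthogonal, and the
density of the dyads. Normalizing in `H₀¹` yields orthonormal bases of `H₀¹(Ω₁) ⊗ H₀¹(Ω₂)` and of
`H₀¹(Ω₁ × Ω₂)`, both indexed by pairs `(j, k)`, and the isometry `Φ` matches them.
-/

noncomputable section

namespace ProductDirichlet

open H01

variable {ι κ : Type} [Fintype ι] [Fintype κ] {Ω : Domain ι} {Ω₁ : Domain ι} {Ω₂ : Domain κ}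

/-! ### The Hilbert space `H₀¹(Ω)` -/

lemma IsTestFunction.eq_zero_of_notMem {φ : (ι → ℝ) → ℝ} (hφ : IsTestFunction Ω φ) {x : ι → ℝ}
    (hx : x ∉ Ω.carrier) : φ x = 0 :=
  image_eq_zero_of_notMem_tsupport fun h => hx (hφ.subset h)

lemma continuous_pderiv {φ : (ι → ℝ) → ℝ} (hφ : ContDiff ℝ ∞ φ) (i : ι) :
    Continuous (pderiv φ i) :=
  (hφ.continuous_fderiv (by simp)).clm_apply continuous_const

lemma hasCompactSupport_pderiv {ι : Type} {φ : (ι → ℝ) → ℝ} (hφ : HasCompactSupport φ) (i : ι) :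
    HasCompactSupport (pderiv φ i) :=
  hφ.fderiv_apply ℝ _

lemma tsupport_pderiv_subset {ι : Type} (φ : (ι → ℝ) → ℝ) (i : ι) :
    tsupport (pderiv φ i) ⊆ tsupport φ :=
  tsupport_fderiv_apply_subset ℝ _

lemma IsTestFunction.memLp {φ : (ι → ℝ) → ℝ} (hφ : IsTestFunction Ω φ) :
    MemLp φ 2 (volume.restrict Ω.carrier) :=
  (hφ.smooth.continuous.memLp_of_hasCompactSupport hφ.compact).restrict _

lemma IsTestFunction.memLp_pderiv {φ : (ι → ℝ) → ℝ} (hφ : IsTestFunction Ω φ) (i : ι) :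
    MemLp (pderiv φ i) 2 (volume.restrict Ω.carrier) :=
  ((continuous_pderiv hφ.smooth i).memLp_of_hasCompactSupport
    (hasCompactSupport_pderiv hφ.compact i)).restrict _

lemma L2.inner_eq_integral (f g : L2 Ω) : inner ℝ f g = ∫ x in Ω.carrier, f x * g x := by
  rw [MeasureTheory.L2.inner_def]
  exact integral_congr_ae (by filter_upwards with x; simp [mul_comm])

/-- Test functions separate the elements of `L²(Ω)`. -/
lemma L2.eq_zero_of_forall_integral_test {f : L2 Ω}
    (h : ∀ ψ, IsTestFunction Ω ψ → ∫ x in Ω.carrier, f x * ψ x = 0) : f = 0 := by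
  have hloc : LocallyIntegrableOn f Ω.carrier volume :=
    locallyIntegrableOn_of_locallyIntegrable_restrict
      ((Lp.memLp f).locallyIntegrable (by norm_num))
  have := Ω.isOpen.ae_eq_zero_of_integral_contDiff_smul_eq_zero hloc fun g hg hc hs => by
    have hg' : IsTestFunction Ω g := ⟨hg, hc, hs⟩
    rw [← h g hg', setIntegral_eq_integral_of_forall_compl_eq_zero fun x hx => by
      simp [hg'.eq_zero_of_notMem hx]]
    simp [mul_comm]
  rw [Lp.eq_zero_iff_ae_eq_zero, Filter.EventuallyEq, ae_restrict_iff' Ω.isOpen.measurableSet]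
  exact this

namespace H01

/-- A closed condition on a function and its gradient that holds for all test functions holds on
`H₀¹(Ω)`. -/
lemma mem_of_isClosed {S : Set (L2 Ω × (ι → L2 Ω))} (hS : IsClosed S)
    (h : (testGraph Ω : Set (L2 Ω × (ι → L2 Ω))) ⊆ S) (u : H01 Ω) :
    (u.toL2, fun i => u.wderiv i) ∈ S :=
  closure_minimal h hS u.2

lemma exists_of_test {φ : (ι → ℝ) → ℝ} (hφ : IsTestFunction Ω φ) :
    ∃ u : H01 Ω, u.toL2 =ᵐ[volume.restrict Ω.carrier] φ ∧
      ∀ i, u.wderiv i =ᵐ[volume.restrict Ω.carrier] pderiv φ i :=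
  ⟨⟨(hφ.memLp.toLp _, fun i => (hφ.memLp_pderiv i).toLp _), subset_closure
    ⟨φ, hφ, hφ.memLp.coeFn_toLp, fun i => (hφ.memLp_pderiv i).coeFn_toLp⟩⟩,
    hφ.memLp.coeFn_toLp, fun i => (hφ.memLp_pderiv i).coeFn_toLp⟩

lemma ext_toL2_wderiv {u v : H01 Ω} (h : u.toL2 = v.toL2) (h' : ∀ i, u.wderiv i = v.wderiv i) :
    u = v :=
  Subtype.ext (Prod.ext h (funext h'))

/-- An element of `H₀¹(Ω)` is determined by its `L²` function: weak gradients are unique. -/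
lemma toL2_injective : Function.Injective (toL2 : H01 Ω → L2 Ω) := by
  refine (injective_iff_map_eq_zero _).2 fun u hu => ?_
  refine ext_toL2_wderiv (by simpa using hu) fun i => ?_
  rw [map_zero]
  refine L2.eq_zero_of_forall_integral_test fun ψ hψ => ?_
  have h0 : ∫ x in Ω.carrier, u.toL2 x * pderiv ψ i x = 0 := by
    rw [hu]
    refine integral_eq_zero_of_ae ?_
    filter_upwards [Lp.coeFn_zero ℝ 2 (volume.restrict Ω.carrier)] with x hx
    exact mul_eq_zero_of_left hx _
  have := integral_toL2_mul_pderiv u i hψ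
  rw [h0] at this
  linarith

lemma l2Inner_eq (u v : H01 Ω) : l2Inner u v = inner ℝ u.toL2 v.toL2 :=
  (L2.inner_eq_integral _ _).symm

section Norm

variable [Nonempty ι]

lemma inner_eq_gradInner (u v : H01 Ω) : inner ℝ u v = gradInner u v := rfl

lemma norm_sq_eq (u : H01 Ω) : ‖u‖ ^ 2 = ∑ i, ‖u.wderiv i‖ ^ 2 := by
  rw [← real_inner_self_eq_norm_sq, inner_eq_gradInner, gradInner_eq]
  simp

lemma norm_wderiv_le (u : H01 Ω) (i : ι) : ‖u.wderiv i‖ ≤ ‖u‖ := by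
  refine le_of_sq_le_sq ?_ (norm_nonneg _)
  rw [norm_sq_eq]
  exact Finset.single_le_sum (f := fun i => ‖u.wderiv i‖ ^ 2) (fun _ _ => sq_nonneg _)
    (Finset.mem_univ i)

variable (Ω) in
lemma exists_norm_toL2_le : ∃ C : ℝ, 0 ≤ C ∧ ∀ u : H01 Ω, ‖u.toL2‖ ≤ C * ‖u‖ := by
  obtain ⟨C, hC0, hC⟩ := poincare Ω
  exact ⟨C, hC0, fun u => (hC u (Classical.arbitrary ι)).trans
    (mul_le_mul_of_nonneg_left (norm_wderiv_le u _) hC0)⟩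

variable (Ω) in
/-- The inclusion `H₀¹(Ω) → L²(Ω)` as a bounded operator. -/
def toL2L : H01 Ω →L[ℝ] L2 Ω :=
  (toL2 : H01 Ω →ₗ[ℝ] L2 Ω).mkContinuous _ (exists_norm_toL2_le Ω).choose_spec.2

/-- The weak partial derivative `∂ᵢ : H₀¹(Ω) → L²(Ω)` as a bounded operator. -/
def wderivL (i : ι) : H01 Ω →L[ℝ] L2 Ω :=
  (wderiv i : H01 Ω →ₗ[ℝ] L2 Ω).mkContinuous 1 fun u => by simpa using norm_wderiv_le u i

/-- By the Poincaré inequality the Dirichlet norm is equivalent to the graph norm, for which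
`H₀¹(Ω)` is a closed subspace of a complete space. -/
instance : CompleteSpace (H01 Ω) := by
  let j : H01 Ω →L[ℝ] L2 Ω × (ι → L2 Ω) :=
    (toL2L Ω).prod (ContinuousLinearMap.pi fun i => wderivL i)
  have hanti : ∃ K, AntilipschitzWith K j := by
    refine ⟨NNReal.sqrt (Fintype.card ι), j.antilipschitz_of_bound fun u => ?_⟩
    refine le_of_sq_le_sq ?_ (by positivity)
    have h1 : ∀ i, ‖u.wderiv i‖ ≤ ‖j u‖ := fun i =>
      (norm_le_pi_norm (fun i => u.wderiv i) i).trans (le_max_right _ _)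
    rw [norm_sq_eq, mul_pow]
    calc ∑ i, ‖u.wderiv i‖ ^ 2 ≤ ∑ _i : ι, ‖j u‖ ^ 2 :=
          Finset.sum_le_sum fun i _ => pow_le_pow_left₀ (norm_nonneg _) (h1 i) 2
      _ = _ := by simp
  obtain ⟨K, hK⟩ := hanti
  have hrange : range j = ((testGraph Ω).topologicalClosure : Set (L2 Ω × (ι → L2 Ω))) := by
    ext p
    exact ⟨by rintro ⟨u, rfl⟩; exact u.2, fun hp => ⟨(⟨p, hp⟩ : H01 Ω), rfl⟩⟩
  have hcomp : IsComplete (range j) := by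
    rw [hrange]
    exact (testGraph Ω).isClosed_topologicalClosure.isComplete
  exact completeSpace_of_isComplete_univ
    (((hK.isUniformInducing j.uniformContinuous).isComplete_iff).1 (by simpa using hcomp))

end Norm

end H01

/-! ### The compactness of the inclusion `H₀¹(Ω) → L²(Ω)` -/

lemma fderiv_eq_sum_pderiv (φ : (ι → ℝ) → ℝ) (x h : ι → ℝ) :
    fderiv ℝ φ x h = ∑ i, h i * pderiv φ i x := by
  classical
  have : h = ∑ i, h i • (Pi.single i 1 : ι → ℝ) := by
    ext j
    simp [Finset.sum_apply, Pi.single_apply]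
  conv_lhs => rw [this]
  rw [map_sum]
  refine Finset.sum_congr rfl fun i _ => ?_
  rw [map_smul, smul_eq_mul, pderiv]

lemma fderiv_apply_sq_le (φ : (ι → ℝ) → ℝ) (x h : ι → ℝ) :
    (fderiv ℝ φ x h) ^ 2 ≤ ‖h‖ ^ 2 * (Fintype.card ι * ∑ i, pderiv φ i x ^ 2) := by
  rw [fderiv_eq_sum_pderiv]
  calc (∑ i, h i * pderiv φ i x) ^ 2 ≤ Fintype.card ι * ∑ i, (h i * pderiv φ i x) ^ 2 :=
        sq_sum_le_card_mul_sum_sq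
    _ ≤ Fintype.card ι * ∑ i, ‖h‖ ^ 2 * pderiv φ i x ^ 2 := by
        gcongr with i
        rw [mul_pow]
        have : h i ^ 2 ≤ ‖h‖ ^ 2 := by
          rw [← sq_abs]
          exact pow_le_pow_left₀ (abs_nonneg _) (norm_le_pi_norm h i) 2
        exact mul_le_mul_of_nonneg_right this (sq_nonneg _)
    _ = _ := by rw [← Finset.mul_sum]; ring

lemma integrable_sq_of_hasCompactSupport {f : (ι → ℝ) → ℝ} (hf : Continuous f)
    (hc : HasCompactSupport f) : Integrable fun x => f x ^ 2 := by
  simp_rw [sq]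
  exact (hf.mul hf).integrable_of_hasCompactSupport hc.mul_right

lemma integrable_quadratic {α : Type*} [MeasurableSpace α] {μ : Measure α} [IsFiniteMeasure μ]
    {f : α → ℝ} (h1 : Integrable f μ) (h2 : Integrable (fun x => f x ^ 2) μ) (a b c : ℝ) :
    Integrable (fun x => a * f x ^ 2 + b * f x + c) μ :=
  ((h2.const_mul a).add (h1.const_mul b)).add (integrable_const c)

lemma integral_quadratic {α : Type*} [MeasurableSpace α] {μ : Measure α} [IsFiniteMeasure μ]
    {f : α → ℝ} (h1 : Integrable f μ) (h2 : Integrable (fun x => f x ^ 2) μ) (a b c : ℝ) :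
    ∫ x, (a * f x ^ 2 + b * f x + c) ∂μ =
      a * ∫ x, f x ^ 2 ∂μ + b * ∫ x, f x ∂μ + μ.real univ * c := by
  have e1 : ∫ x, (a * f x ^ 2 + b * f x + c) ∂μ =
      ∫ x, (a * f x ^ 2 + b * f x) ∂μ + ∫ _x, c ∂μ :=
    integral_add ((h2.const_mul a).add (h1.const_mul b)) (integrable_const c)
  have e2 : ∫ x, (a * f x ^ 2 + b * f x) ∂μ = ∫ x, a * f x ^ 2 ∂μ + ∫ x, b * f x ∂μ :=
    integral_add (h2.const_mul a) (h1.const_mul b)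
  rw [e1, e2, integral_const_mul, integral_const_mul, integral_const, smul_eq_mul]

/-- The Cauchy–Schwarz inequality against the constant function on the unit interval. -/
lemma sq_integral_unitInterval_le {g : ℝ → ℝ} (hg : Continuous g) :
    (∫ t in Icc (0 : ℝ) 1, g t) ^ 2 ≤ ∫ t in Icc (0 : ℝ) 1, g t ^ 2 := by
  set c := ∫ t in Icc (0 : ℝ) 1, g t with hc
  have i1 : IntegrableOn g (Icc (0 : ℝ) 1) := hg.continuousOn.integrableOn_Icc
  have i2 : IntegrableOn (fun t => g t ^ 2) (Icc (0 : ℝ) 1) :=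
    (by fun_prop : Continuous fun t => g t ^ 2).continuousOn.integrableOn_Icc
  have h0 : 0 ≤ ∫ t in Icc (0 : ℝ) 1, (g t - c) ^ 2 := integral_nonneg fun t => sq_nonneg _
  have h1 : ∀ t, (g t - c) ^ 2 = 1 * g t ^ 2 + (-2 * c) * g t + c ^ 2 := fun t => by ring
  simp_rw [h1] at h0
  rw [integral_quadratic i1 i2, ← hc] at h0
  simp at h0
  linarith

/-- The `L²` modulus of continuity of a smooth function is controlled by its gradient. -/
lemma lintegral_translate_sub_sq_le {φ : (ι → ℝ) → ℝ} (hφ : ContDiff ℝ ∞ φ) (h : ι → ℝ) :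
    ∫⁻ x, ENNReal.ofReal ((φ (x + h) - φ x) ^ 2) ≤
      ∫⁻ x, ENNReal.ofReal ((fderiv ℝ φ x h) ^ 2) := by
  have cd : Continuous fun x => fderiv ℝ φ x h :=
    (hφ.continuous_fderiv (by simp)).clm_apply continuous_const
  have hpt : ∀ x, ENNReal.ofReal ((φ (x + h) - φ x) ^ 2) ≤
      ∫⁻ t in Icc (0 : ℝ) 1, ENNReal.ofReal ((fderiv ℝ φ (x + t • h) h) ^ 2) := by
    intro x
    have cl : Continuous fun t : ℝ => fderiv ℝ φ (x + t • h) h := cd.comp (by fun_prop)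
    have hder : ∀ t : ℝ, HasDerivAt (fun t : ℝ => φ (x + t • h)) (fderiv ℝ φ (x + t • h) h) t := by
      intro t
      have h1 : HasDerivAt (fun t : ℝ => x + t • h) h t := by
        simpa using ((hasDerivAt_id t).smul_const h).const_add x
      exact ((hφ.differentiable (by simp)) (x + t • h)).hasFDerivAt.comp_hasDerivAt t h1
    have e := intervalIntegral.integral_eq_sub_of_hasDerivAt (fun t _ => hder t)
      (cl.intervalIntegrable 0 1)
    simp only [one_smul, zero_smul, add_zero] at e
    rw [intervalIntegral.integral_of_le zero_le_one, ← integral_Icc_eq_integral_Ioc] at e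
    rw [← e, ← ofReal_integral_eq_lintegral_ofReal
      ((by fun_prop : Continuous fun t : ℝ =>
        (fderiv ℝ φ (x + t • h) h) ^ 2).continuousOn.integrableOn_Icc)
      (ae_of_all _ fun t => sq_nonneg _)]
    exact ENNReal.ofReal_le_ofReal (sq_integral_unitInterval_le cl)
  calc _ ≤ ∫⁻ x, ∫⁻ t in Icc (0 : ℝ) 1, ENNReal.ofReal ((fderiv ℝ φ (x + t • h) h) ^ 2) :=
        lintegral_mono hpt
    _ = ∫⁻ t in Icc (0 : ℝ) 1, ∫⁻ x, ENNReal.ofReal ((fderiv ℝ φ (x + t • h) h) ^ 2) := by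
        refine lintegral_lintegral_swap (Measurable.aemeasurable ?_)
        have : Continuous fun p : (ι → ℝ) × ℝ => fderiv ℝ φ (p.1 + p.2 • h) h :=
          cd.comp (by fun_prop)
        exact (this.pow 2).measurable.ennreal_ofReal
    _ = ∫⁻ _t in Icc (0 : ℝ) 1, ∫⁻ x, ENNReal.ofReal ((fderiv ℝ φ x h) ^ 2) := by
        congr 1; ext t
        exact lintegral_add_right_eq_self
          (fun x => ENNReal.ofReal ((fderiv ℝ φ x h) ^ 2)) (t • h)
    _ = _ := by simp

/-- The variance identity on a set of finite measure. -/
lemma lintegral_lintegral_sub_sq {f : (ι → ℝ) → ℝ} (hf : Continuous f) (hc : HasCompactSupport f)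
    {Q : Set (ι → ℝ)} {V : ℝ} (hV : 0 ≤ V) (hQ : volume Q = ENNReal.ofReal V) :
    ∫⁻ x in Q, ∫⁻ y in Q, ENNReal.ofReal ((f x - f y) ^ 2) =
      ENNReal.ofReal (2 * (V * ∫ x in Q, f x ^ 2) - 2 * (∫ x in Q, f x) ^ 2) := by
  have : IsFiniteMeasure (volume.restrict Q) := ⟨by simp [hQ]⟩
  have i1 : Integrable f (volume.restrict Q) := (hf.integrable_of_hasCompactSupport hc).restrict
  have i2 : Integrable (fun x => f x ^ 2) (volume.restrict Q) :=
    (integrable_sq_of_hasCompactSupport hf hc).restrict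
  have hVr : (volume.restrict Q).real univ = V := by simp [Measure.real, hQ, hV]
  set A := ∫ x in Q, f x with hA
  set B := ∫ x in Q, f x ^ 2 with hB
  have hexp : ∀ x y, (f x - f y) ^ 2 = 1 * f y ^ 2 + (-2 * f x) * f y + f x ^ 2 :=
    fun x y => by ring
  have hin : ∀ x, ∫ y in Q, (f x - f y) ^ 2 = V * f x ^ 2 + (-2 * A) * f x + B := by
    intro x
    simp_rw [hexp]
    rw [integral_quadratic i1 i2, hVr, ← hA, ← hB]
    ring
  have hsq : ∀ x, Integrable (fun y => (f x - f y) ^ 2) (volume.restrict Q) := by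
    intro x
    simp_rw [hexp]
    exact integrable_quadratic i1 i2 _ _ _
  have hin' : ∀ x, ∫⁻ y in Q, ENNReal.ofReal ((f x - f y) ^ 2) =
      ENNReal.ofReal (V * f x ^ 2 + (-2 * A) * f x + B) := fun x => by
    rw [← hin x, ofReal_integral_eq_lintegral_ofReal (hsq x) (ae_of_all _ fun y => sq_nonneg _)]
  simp_rw [hin']
  rw [← ofReal_integral_eq_lintegral_ofReal (integrable_quadratic i1 i2 _ _ _)
    (ae_of_all _ fun x => ?_)]
  · rw [integral_quadratic i1 i2, hVr, ← hA, ← hB]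
    congr 1
    ring
  · simp only [Pi.zero_apply]
    rw [← hin x]
    exact integral_nonneg fun y => sq_nonneg _

/-- The total variance of a test function over finitely many disjoint small cells of equal volume
is controlled by its Dirichlet integral. -/
lemma sum_variance_le {φ : (ι → ℝ) → ℝ} (hφ : ContDiff ℝ ∞ φ) (hc : HasCompactSupport φ)
    {σ : Type*} (K : Finset σ) (Q : σ → Set (ι → ℝ)) (hm : ∀ k, MeasurableSet (Q k))
    (hd : Pairwise (Function.onFun Disjoint Q)) {V ε : ℝ} (hV : 0 ≤ V) (hε : 0 ≤ ε)
    (hQ : ∀ k, volume (Q k) = ENNReal.ofReal V)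
    (hdiam : ∀ k, ∀ x ∈ Q k, ∀ y ∈ Q k, ‖y - x‖ ≤ ε) :
    ∑ k ∈ K, (2 * (V * ∫ x in Q k, φ x ^ 2) - 2 * (∫ x in Q k, φ x) ^ 2) ≤
      (2 * ε) ^ Fintype.card ι *
        (ε ^ 2 * (Fintype.card ι * ∑ i, ∫ x, pderiv φ i x ^ 2)) := by
  have cφ := hφ.continuous
  set B : Set (ι → ℝ) := Metric.closedBall 0 ε with hB
  set g : (ι → ℝ) → (ι → ℝ) → ENNReal := fun x h => ENNReal.ofReal ((φ (x + h) - φ x) ^ 2) with hg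
  have hgm : Measurable (Function.uncurry g) := by
    have : Continuous fun p : (ι → ℝ) × (ι → ℝ) => φ (p.1 + p.2) - φ p.1 := by fun_prop
    exact (this.pow 2).measurable.ennreal_ofReal
  -- Two points of one cell differ by a translation of length at most `ε`.
  have hcell : ∀ k, ∫⁻ x in Q k, ∫⁻ y in Q k, ENNReal.ofReal ((φ x - φ y) ^ 2) ≤
      ∫⁻ x in Q k, ∫⁻ h in B, g x h := by
    intro k
    refine setLIntegral_mono' (hm k) fun x hx => ?_
    rw [← lintegral_indicator (hm k),
      ← lintegral_indicator Metric.isClosed_closedBall.measurableSet,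
      ← lintegral_add_left_eq_self _ x]
    refine lintegral_mono fun h => ?_
    by_cases hh : x + h ∈ Q k
    · have hhB : h ∈ B := by simpa [hB] using hdiam k x hx _ hh
      rw [indicator_of_mem hh, indicator_of_mem hhB]
      exact le_of_eq (by rw [hg]; congr 1; ring)
    · simp [indicator_of_notMem hh]
  have hD : ∀ i, Integrable fun x => pderiv φ i x ^ 2 := fun i =>
    integrable_sq_of_hasCompactSupport (continuous_pderiv hφ i) (hasCompactSupport_pderiv hc i)
  have htr : ∀ h ∈ B, ∫⁻ x, g x h ≤
      ENNReal.ofReal (ε ^ 2 * (Fintype.card ι * ∑ i, ∫ x, pderiv φ i x ^ 2)) := by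
    intro h hh
    have hh' : ‖h‖ ≤ ε := by simpa [hB] using hh
    calc ∫⁻ x, g x h ≤ ∫⁻ x, ENNReal.ofReal ((fderiv ℝ φ x h) ^ 2) :=
          lintegral_translate_sub_sq_le hφ h
      _ ≤ ∫⁻ x, ENNReal.ofReal (ε ^ 2 * (Fintype.card ι * ∑ i, pderiv φ i x ^ 2)) := by
          refine lintegral_mono fun x => ENNReal.ofReal_le_ofReal ?_
          refine (fderiv_apply_sq_le φ x h).trans ?_
          have : 0 ≤ ∑ i, pderiv φ i x ^ 2 := Finset.sum_nonneg fun _ _ => sq_nonneg _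
          gcongr
      _ = _ := by
          rw [← ofReal_integral_eq_lintegral_ofReal
            (((integrable_finsetSum _ fun i _ => hD i).const_mul _).const_mul _)
            (ae_of_all _ fun x => by
              have : 0 ≤ ∑ i, pderiv φ i x ^ 2 := Finset.sum_nonneg fun _ _ => sq_nonneg _
              simp only [Pi.zero_apply]; positivity)]
          rw [integral_const_mul, integral_const_mul, integral_finsetSum _ fun i _ => hD i]
  have hDnn : 0 ≤ ∑ i, ∫ x, pderiv φ i x ^ 2 :=
    Finset.sum_nonneg fun _ _ => integral_nonneg fun _ => sq_nonneg _
  rw [← ENNReal.ofReal_le_ofReal_iff (by positivity)]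
  calc ENNReal.ofReal (∑ k ∈ K, (2 * (V * ∫ x in Q k, φ x ^ 2) - 2 * (∫ x in Q k, φ x) ^ 2))
      ≤ ∑ k ∈ K, ENNReal.ofReal (2 * (V * ∫ x in Q k, φ x ^ 2) - 2 * (∫ x in Q k, φ x) ^ 2) :=
        Finset.le_sum_of_subadditive _ ENNReal.ofReal_zero.le
          (fun _ _ => ENNReal.ofReal_add_le) _ _
    _ = ∑ k ∈ K, ∫⁻ x in Q k, ∫⁻ y in Q k, ENNReal.ofReal ((φ x - φ y) ^ 2) := by
        refine Finset.sum_congr rfl fun k _ => ?_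
        rw [lintegral_lintegral_sub_sq cφ hc hV (hQ k)]
    _ ≤ ∑ k ∈ K, ∫⁻ x in Q k, ∫⁻ h in B, g x h := Finset.sum_le_sum fun k _ => hcell k
    _ = ∫⁻ x in ⋃ k ∈ K, Q k, ∫⁻ h in B, g x h :=
        (lintegral_biUnion_finset (fun i _ j _ hij => hd hij) (fun k _ => hm k) _).symm
    _ ≤ ∫⁻ x, ∫⁻ h in B, g x h := setLIntegral_le_lintegral _ _
    _ = ∫⁻ h in B, ∫⁻ x, g x h := lintegral_lintegral_swap hgm.aemeasurable
    _ ≤ ∫⁻ _h in B, ENNReal.ofReal (ε ^ 2 * (Fintype.card ι * ∑ i, ∫ x, pderiv φ i x ^ 2)) :=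
        setLIntegral_mono' Metric.isClosed_closedBall.measurableSet htr
    _ = _ := by
        rw [setLIntegral_const, hB, Real.volume_pi_closedBall _ hε,
          ← ENNReal.ofReal_mul (by positivity)]
        ring_nf

/-- The half-open cube of side `ε` with lower corner `ε k`, a cell of the grid `ε ℤ^ι`. -/
def gridCell (ε : ℝ) (k : ι → ℤ) : Set (ι → ℝ) :=
  univ.pi fun i => Ico (k i * ε) (k i * ε + ε)

lemma mem_gridCell_iff {ι : Type} {ε : ℝ} (hε : 0 < ε) (k : ι → ℤ) (x : ι → ℝ) :
    x ∈ gridCell ε k ↔ ∀ i, ⌊x i / ε⌋ = k i := by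
  simp only [gridCell, mem_univ_pi, mem_Ico, Int.floor_eq_iff, le_div_iff₀ hε, div_lt_iff₀ hε,
    add_mul, one_mul]

lemma measurableSet_gridCell (ε : ℝ) (k : ι → ℤ) : MeasurableSet (gridCell ε k) :=
  MeasurableSet.univ_pi fun _ => measurableSet_Ico

lemma pairwise_disjoint_gridCell {ι : Type} {ε : ℝ} (hε : 0 < ε) :
    Pairwise (Function.onFun Disjoint (gridCell (ι := ι) ε)) := fun k l hkl =>
  Set.disjoint_left.2 fun x hk hl => hkl <| funext fun i =>
    ((mem_gridCell_iff hε k x).1 hk i).symm.trans ((mem_gridCell_iff hε l x).1 hl i)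

lemma volume_gridCell {ε : ℝ} (hε : 0 < ε) (k : ι → ℤ) :
    volume (gridCell ε k) = ENNReal.ofReal (ε ^ Fintype.card ι) := by
  rw [gridCell, Real.volume_pi_Ico, ENNReal.ofReal_pow hε.le]
  simp

lemma norm_sub_le_of_mem_gridCell {ε : ℝ} (hε : 0 < ε) (k : ι → ℤ) :
    ∀ x ∈ gridCell ε k, ∀ y ∈ gridCell ε k, ‖y - x‖ ≤ ε := by
  intro x hx y hy
  refine (pi_norm_le_iff_of_nonneg hε.le).2 fun i => ?_
  have h1 := hx i (mem_univ i)
  have h2 := hy i (mem_univ i)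
  rw [mem_Ico] at h1 h2
  rw [Pi.sub_apply, Real.norm_eq_abs, abs_le]
  constructor <;> linarith

lemma Domain.exists_finset_gridCell (Ω : Domain ι) {ε : ℝ} (hε : 0 < ε) :
    ∃ K : Finset (ι → ℤ), Ω.carrier ⊆ ⋃ k ∈ K, gridCell ε k := by
  classical
  obtain ⟨R, hR⟩ := Ω.isBounded.exists_norm_le
  refine ⟨Fintype.piFinset fun _ => Finset.Icc ⌊-R / ε⌋ ⌊R / ε⌋, fun x hx => ?_⟩
  refine mem_iUnion₂.2 ⟨fun i => ⌊x i / ε⌋, ?_, (mem_gridCell_iff hε _ x).2 fun _ => rfl⟩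
  rw [Fintype.mem_piFinset]
  intro i
  have := abs_le.1 ((norm_le_pi_norm x i).trans (hR x hx))
  rw [Finset.mem_Icc]
  exact ⟨Int.floor_mono (div_le_div_of_nonneg_right this.1 hε.le),
    Int.floor_mono (div_le_div_of_nonneg_right this.2 hε.le)⟩

/-- For a test function, the variance estimate on a fine grid. -/
lemma integral_sq_test_le {φ : (ι → ℝ) → ℝ} (hφ : IsTestFunction Ω φ) {ε : ℝ} (hε : 0 < ε)
    {K : Finset (ι → ℤ)} (hK : Ω.carrier ⊆ ⋃ k ∈ K, gridCell ε k) :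
    ∫ x in Ω.carrier, φ x ^ 2 ≤ (ε ^ Fintype.card ι)⁻¹ *
        ∑ k ∈ K, (∫ x in gridCell ε k, φ x ∂(volume.restrict Ω.carrier)) ^ 2 +
      2 ^ Fintype.card ι * Fintype.card ι * ε ^ 2 *
        ∑ i, ∫ x in Ω.carrier, pderiv φ i x ^ 2 := by
  have e0 : ∀ k, ∫ x in gridCell ε k, φ x ∂(volume.restrict Ω.carrier) =
      ∫ x in gridCell ε k, φ x := fun k => by
    rw [Measure.restrict_restrict (measurableSet_gridCell ε k)]
    exact (setIntegral_eq_of_subset_of_forall_sdiff_eq_zero (measurableSet_gridCell ε k)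
      inter_subset_left fun x hx => hφ.eq_zero_of_notMem fun h => hx.2 ⟨hx.1, h⟩).symm
  have e1 : ∀ i, ∫ x in Ω.carrier, pderiv φ i x ^ 2 = ∫ x, pderiv φ i x ^ 2 := fun i =>
    setIntegral_eq_integral_of_forall_compl_eq_zero fun x hx => by
      have : pderiv φ i x = 0 := image_eq_zero_of_notMem_tsupport fun h =>
        hx (hφ.subset (tsupport_pderiv_subset φ i h))
      simp [this]
  have e2 : ∫ x in Ω.carrier, φ x ^ 2 = ∑ k ∈ K, ∫ x in gridCell ε k, φ x ^ 2 := by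
    rw [← integral_biUnion_finset K (fun k _ => measurableSet_gridCell ε k)
      (fun k _ l _ hkl => pairwise_disjoint_gridCell hε hkl)
      (fun k _ =>
        (integrable_sq_of_hasCompactSupport hφ.smooth.continuous hφ.compact).integrableOn)]
    refine (setIntegral_eq_of_subset_of_forall_sdiff_eq_zero
      (Finset.measurableSet_biUnion K fun k _ => measurableSet_gridCell ε k) hK
      fun x hx => ?_).symm
    simp [hφ.eq_zero_of_notMem hx.2]
  simp_rw [e0, e1]
  rw [e2]
  have hV : 0 < ε ^ Fintype.card ι := by positivity
  have key := sum_variance_le hφ.smooth hφ.compact K (gridCell ε) (measurableSet_gridCell ε)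
    (pairwise_disjoint_gridCell hε) hV.le hε.le (volume_gridCell hε)
    (norm_sub_le_of_mem_gridCell hε)
  rw [Finset.sum_sub_distrib, ← Finset.mul_sum, ← Finset.mul_sum, ← Finset.mul_sum, mul_pow] at key
  set A := ∑ k ∈ K, ∫ x in gridCell ε k, φ x ^ 2
  set B := ∑ k ∈ K, (∫ x in gridCell ε k, φ x) ^ 2
  have hD : 0 ≤ ∑ i, ∫ x, pderiv φ i x ^ 2 :=
    Finset.sum_nonneg fun _ _ => integral_nonneg fun _ => sq_nonneg _
  set D := ∑ i, ∫ x, pderiv φ i x ^ 2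
  set V := ε ^ Fintype.card ι
  have hD' : 0 ≤ V * (2 ^ Fintype.card ι * Fintype.card ι * ε ^ 2 * D) := by positivity
  rw [← mul_le_mul_iff_right₀ hV, mul_add, ← mul_assoc V, mul_inv_cancel₀ hV.ne', one_mul]
  nlinarith

/-- Rellich's inequality: up to an arbitrarily small multiple of the Dirichlet norm, the `L²` norm
is controlled by finitely many `L²`-continuous functionals. -/
lemma exists_rellich_le [Nonempty ι] (Ω : Domain ι) {δ : ℝ} (hδ : 0 < δ) :
    ∃ (K : Finset (ι → ℤ)) (g : (ι → ℤ) → L2 Ω) (A : ℝ), ∀ u : H01 Ω,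
      ‖u.toL2‖ ^ 2 ≤ A * ∑ k ∈ K, (inner ℝ (g k) u.toL2) ^ 2 + δ ^ 2 * ‖u‖ ^ 2 := by
  set C : ℝ := 2 ^ Fintype.card ι * Fintype.card ι with hC
  have hC0 : 0 < C := by positivity
  set ε : ℝ := δ / √C with hεdef
  have hε : 0 < ε := by positivity
  have hCε : C * ε ^ 2 = δ ^ 2 := by
    rw [hεdef, div_pow, Real.sq_sqrt hC0.le]
    field_simp
  obtain ⟨K, hK⟩ := Ω.exists_finset_gridCell hε
  have hfin : ∀ k : ι → ℤ, volume.restrict Ω.carrier (gridCell ε k) ≠ ⊤ := fun k =>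
    ((Measure.restrict_apply_le _ _).trans_lt
      (by rw [volume_gridCell hε]; exact ENNReal.ofReal_lt_top)).ne
  let g : (ι → ℤ) → L2 Ω := fun k => indicatorConstLp 2 (measurableSet_gridCell ε k) (hfin k) 1
  refine ⟨K, g, (ε ^ Fintype.card ι)⁻¹, fun u => ?_⟩
  have hcl : IsClosed {p : L2 Ω × (ι → L2 Ω) | ‖p.1‖ ^ 2 ≤
      (ε ^ Fintype.card ι)⁻¹ * ∑ k ∈ K, (inner ℝ (g k) p.1) ^ 2 +
        δ ^ 2 * ∑ i, ‖p.2 i‖ ^ 2} :=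
    isClosed_le (by fun_prop) (by fun_prop)
  have := mem_of_isClosed hcl ?_ u
  · rw [norm_sq_eq]; exact this
  rintro p ⟨φ, hφ, hp, hp'⟩
  have h1 : ‖p.1‖ ^ 2 = ∫ x in Ω.carrier, φ x ^ 2 := by
    rw [← real_inner_self_eq_norm_sq, L2.inner_eq_integral]
    exact integral_congr_ae (by filter_upwards [hp] with x hx; simp [hx, sq])
  have h2 : ∀ i, ‖p.2 i‖ ^ 2 = ∫ x in Ω.carrier, pderiv φ i x ^ 2 := fun i => by
    rw [← real_inner_self_eq_norm_sq, L2.inner_eq_integral]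
    exact integral_congr_ae (by filter_upwards [hp' i] with x hx; simp [hx, sq])
  have h3 : ∀ k, inner ℝ (g k) p.1 =
      ∫ x in gridCell ε k, φ x ∂(volume.restrict Ω.carrier) := fun k => by
    rw [MeasureTheory.L2.inner_indicatorConstLp_one]
    exact integral_congr_ae (ae_restrict_of_ae hp)
  have key := integral_sq_test_le hφ hε hK
  rw [← hC, hCε] at key
  simp only [mem_ofPred_eq, h1, h2, h3]
  exact key

/-- An operator that is bounded by finitely many continuous functionals, up to an arbitrarily small
multiple of the norm, is a norm limit of operators of finite rank. -/
lemma isCompactOperator_of_forall_norm_sq_le {H E : Type*} [NormedAddCommGroup H]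
    [InnerProductSpace ℝ H] [CompleteSpace H] [NormedAddCommGroup E] [InnerProductSpace ℝ E]
    [CompleteSpace E] {σ : Type*} (J : H →L[ℝ] E)
    (h : ∀ δ : ℝ, 0 < δ → ∃ (K : Finset σ) (g : σ → E) (A : ℝ), ∀ u : H,
      ‖J u‖ ^ 2 ≤ A * ∑ k ∈ K, (inner ℝ (g k) (J u)) ^ 2 + δ ^ 2 * ‖u‖ ^ 2) :
    IsCompactOperator J := by
  classical
  refine (isClosed_setOfPred_isCompactOperator (σ₁₂ := RingHom.id ℝ)).closure_subset
    (Metric.mem_closure_iff.2 fun δ hδ => ?_)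
  obtain ⟨K, g, A, hA⟩ := h (δ / 2) (half_pos hδ)
  let V : Submodule ℝ H := Submodule.span ℝ (K.image fun k => J.adjoint (g k) : Finset H)
  have : FiniteDimensional ℝ V := inferInstance
  have : ProperSpace V := FiniteDimensional.proper ℝ V
  refine ⟨(J.comp V.subtypeL).comp V.orthogonalProjectionOnto,
    (isCompactOperator_of_locallyCompactSpace_rng (J.comp V.subtypeL)).comp_clm _, ?_⟩
  rw [dist_eq_norm]
  refine (ContinuousLinearMap.opNorm_le_bound _ (half_pos hδ).le fun u => ?_).trans_lt
    (half_lt_self hδ)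
  set w : H := u - V.orthogonalProjectionOnto u with hw
  have hwV : w ∈ Vᗮ := V.sub_starProjection_mem_orthogonal u
  have e : (J - (J.comp V.subtypeL).comp V.orthogonalProjectionOnto) u = J w := by
    simp [hw]
  have hz : ∀ k ∈ K, inner ℝ (g k) (J w) = 0 := fun k hk => by
    rw [← ContinuousLinearMap.adjoint_inner_left]
    exact (Submodule.mem_orthogonal V w).1 hwV _
      (Submodule.subset_span (by simpa using ⟨k, hk, rfl⟩))
  have hwu : ‖w‖ ≤ ‖u‖ := by
    have := Vᗮ.norm_starProjection_apply_le u
    rwa [Submodule.starProjection_orthogonal_val] at this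
  have h1 := hA w
  rw [Finset.sum_eq_zero fun k hk => by rw [hz k hk]; ring, mul_zero, zero_add, ← mul_pow] at h1
  rw [e]
  exact (le_of_sq_le_sq h1 (by positivity)).trans (by gcongr)

/-- Rellich's theorem for `H₀¹`. -/
theorem isCompactOperator_toL2L [Nonempty ι] (Ω : Domain ι) : IsCompactOperator (toL2L Ω) :=
  isCompactOperator_of_forall_norm_sq_le _ fun _ hδ => exists_rellich_le Ω hδ

/-! ### The eigenfunctions are complete -/

section Spectral

variable [Nonempty ι] {lam : ℕ → ℝ} {e : ℕ → H01 Ω}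

lemma inner_eq_of_eigenpair {μ : ℝ} {u : H01 Ω} (h : IsDirichletEigenpair Ω μ u) (v : H01 Ω) :
    inner ℝ u v = μ * inner ℝ u.toL2 v.toL2 := by
  rw [inner_eq_gradInner, h.2 v, l2Inner_eq]

/-- The spectral theorem for the compact operator `J*J`, where `J` is the inclusion of `H₀¹(Ω)` in
`L²(Ω)`: its eigenvectors are the Dirichlet eigenfunctions, with the reciprocal eigenvalues. -/
theorem IsDirichletEigensystem.orthogonal_span_eq_bot (h : IsDirichletEigensystem Ω lam e) :
    (Submodule.span ℝ (range e))ᗮ = ⊥ := by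
  let T : H01 Ω →L[ℝ] H01 Ω := (toL2L Ω).adjoint.comp (toL2L Ω)
  have hT : ∀ u v, inner ℝ (T u) v = inner ℝ u.toL2 v.toL2 := fun u v => by
    rw [ContinuousLinearMap.comp_apply, ContinuousLinearMap.adjoint_inner_left]
    rfl
  have hsymm : (T : H01 Ω →ₗ[ℝ] H01 Ω).IsSymmetric := fun u v => by
    simp only [ContinuousLinearMap.coe_coe]
    rw [hT, real_inner_comm (T v) u, hT, real_inner_comm]
  have hcomp : IsCompactOperator T := (isCompactOperator_toL2L Ω).clm_comp (toL2L Ω).adjoint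
  have hspec := ContinuousLinearMap.orthogonalComplement_iSup_eigenspaces_eq_bot hcomp hsymm
  rw [eq_bot_iff, ← hspec]
  refine Submodule.orthogonal_le (iSup_le fun μ u hu => ?_)
  have hTu : T u = μ • u := Module.End.mem_eigenspace_iff.1 hu
  have hu' : ∀ v, inner ℝ u.toL2 v.toL2 = μ * inner ℝ u v := fun v => by
    rw [← hT, hTu, real_inner_smul_left]
  by_cases hu0 : u = 0
  · rw [hu0]; exact zero_mem _
  have hμ : μ ≠ 0 := by
    rintro rfl
    have := hu' u
    rw [zero_mul, inner_self_eq_zero] at this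
    exact hu0 (toL2_injective (by rw [this, map_zero]))
  refine Submodule.span_mono (image_subset_range _ _) (h.complete μ⁻¹ u ⟨hu0, fun v => ?_⟩)
  rw [l2Inner_eq, hu', ← inner_eq_gradInner, ← mul_assoc, inv_mul_cancel₀ hμ, one_mul]

lemma IsDirichletEigensystem.dense_span (h : IsDirichletEigensystem Ω lam e) :
    Dense (Submodule.span ℝ (range e) : Set (H01 Ω)) := by
  rw [Submodule.dense_iff_topologicalClosure_eq_top,
    Submodule.topologicalClosure_eq_top_iff, h.orthogonal_span_eq_bot]

/-- The eigenfunctions are complete in `L²(Ω)`. -/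
lemma IsDirichletEigensystem.eq_zero_of_forall_inner_toL2 (h : IsDirichletEigensystem Ω lam e)
    {f : L2 Ω} (hf : ∀ j, inner ℝ (e j).toL2 f = 0) : f = 0 := by
  have hall : ∀ u : H01 Ω, inner ℝ u.toL2 f = 0 := by
    intro u
    have hcl : IsClosed {u : H01 Ω | inner ℝ (toL2L Ω u) f = 0} :=
      isClosed_eq (by fun_prop) continuous_const
    refine closure_minimal ?_ hcl (h.dense_span u)
    intro v hv
    induction hv using Submodule.span_induction with
    | mem x hx => obtain ⟨j, rfl⟩ := hx; exact hf j
    | zero => simp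
    | add x y _ _ hx hy => simp_all [inner_add_left]
    | smul a x _ hx => simp_all [inner_smul_left]
  refine L2.eq_zero_of_forall_integral_test fun ψ hψ => ?_
  obtain ⟨u, hu, -⟩ := exists_of_test hψ
  rw [← hall u, L2.inner_eq_integral]
  exact integral_congr_ae (by filter_upwards [hu] with x hx; rw [hx, mul_comm])

lemma IsDirichletEigensystem.lam_pos (h : IsDirichletEigensystem Ω lam e) (j : ℕ) :
    0 < lam j := by
  have h1 := inner_eq_of_eigenpair (h.eigenpair j) (e j)
  rw [← l2Inner_eq, h.orthonormal, if_pos rfl, mul_one] at h1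
  rw [← h1]
  exact real_inner_self_pos.2 (h.eigenpair j).1

end Spectral

/-! ### Integration and tensor products on `Ω₁ × Ω₂` -/

/-- The identification of `ℝ^(ι ⊕ κ)` with `ℝ^ι × ℝ^κ`. -/
abbrev splitEquiv (ι κ : Type) : (ι ⊕ κ → ℝ) ≃ᵐ (ι → ℝ) × (κ → ℝ) :=
  MeasurableEquiv.sumPiEquivProdPi fun _ => ℝ

lemma measurePreserving_splitEquiv (Ω₁ : Domain ι) (Ω₂ : Domain κ) :
    MeasurePreserving (splitEquiv ι κ) (volume.restrict (Ω₁.prod Ω₂).carrier)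
      ((volume.restrict Ω₁.carrier).prod (volume.restrict Ω₂.carrier)) := by
  rw [Measure.prod_restrict]
  exact (volume_measurePreserving_sumPiEquivProdPi fun _ : ι ⊕ κ => ℝ).restrict_preimage
    (Ω₁.isOpen.measurableSet.prod Ω₂.isOpen.measurableSet)

lemma integrable_splitEquiv_iff {F : (ι → ℝ) × (κ → ℝ) → ℝ} :
    Integrable (fun z => F (z ∘ Sum.inl, z ∘ Sum.inr)) (volume.restrict (Ω₁.prod Ω₂).carrier) ↔
      Integrable F ((volume.restrict Ω₁.carrier).prod (volume.restrict Ω₂.carrier)) :=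
  (measurePreserving_splitEquiv Ω₁ Ω₂).integrable_comp_emb (splitEquiv ι κ).measurableEmbedding

lemma setIntegral_prod_carrier (F : (ι → ℝ) × (κ → ℝ) → ℝ) :
    ∫ z in (Ω₁.prod Ω₂).carrier, F (z ∘ Sum.inl, z ∘ Sum.inr) =
      ∫ p, F p ∂((volume.restrict Ω₁.carrier).prod (volume.restrict Ω₂.carrier)) :=
  (measurePreserving_splitEquiv Ω₁ Ω₂).integral_comp' (f := splitEquiv ι κ) F

lemma quasiMeasurePreserving_inl (Ω₁ : Domain ι) (Ω₂ : Domain κ) :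
    Measure.QuasiMeasurePreserving (fun z : ι ⊕ κ → ℝ => z ∘ Sum.inl)
      (volume.restrict (Ω₁.prod Ω₂).carrier) (volume.restrict Ω₁.carrier) :=
  Measure.quasiMeasurePreserving_fst.comp
    (measurePreserving_splitEquiv Ω₁ Ω₂).quasiMeasurePreserving

lemma quasiMeasurePreserving_inr (Ω₁ : Domain ι) (Ω₂ : Domain κ) :
    Measure.QuasiMeasurePreserving (fun z : ι ⊕ κ → ℝ => z ∘ Sum.inr)
      (volume.restrict (Ω₁.prod Ω₂).carrier) (volume.restrict Ω₂.carrier) :=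
  Measure.quasiMeasurePreserving_snd.comp
    (measurePreserving_splitEquiv Ω₁ Ω₂).quasiMeasurePreserving

lemma memLp_tensor {f : (ι → ℝ) → ℝ} {g : (κ → ℝ) → ℝ}
    (hf : MemLp f 2 (volume.restrict Ω₁.carrier)) (hg : MemLp g 2 (volume.restrict Ω₂.carrier)) :
    MemLp (fun z => f (z ∘ Sum.inl) * g (z ∘ Sum.inr)) 2
      (volume.restrict (Ω₁.prod Ω₂).carrier) := by
  have hm : AEStronglyMeasurable (fun z => f (z ∘ Sum.inl) * g (z ∘ Sum.inr))
      (volume.restrict (Ω₁.prod Ω₂).carrier) :=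
    (hf.1.comp_quasiMeasurePreserving (quasiMeasurePreserving_inl Ω₁ Ω₂)).mul
      (hg.1.comp_quasiMeasurePreserving (quasiMeasurePreserving_inr Ω₁ Ω₂))
  rw [memLp_two_iff_integrable_sq hm]
  have := integrable_splitEquiv_iff.2 (hf.integrable_sq.mul_prod hg.integrable_sq)
  simpa only [mul_pow] using this

namespace L2

/-- The tensor product `u(x) v(y)` of two square integrable functions. -/
def tensor (u : L2 Ω₁) (v : L2 Ω₂) : L2 (Ω₁.prod Ω₂) :=
  (memLp_tensor (Lp.memLp u) (Lp.memLp v)).toLp _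

lemma coeFn_tensor (u : L2 Ω₁) (v : L2 Ω₂) :
    tensor u v =ᵐ[volume.restrict (Ω₁.prod Ω₂).carrier]
      fun z => u (z ∘ Sum.inl) * v (z ∘ Sum.inr) :=
  MemLp.coeFn_toLp _

lemma eq_tensor {u : L2 Ω₁} {v : L2 Ω₂} {f : (ι → ℝ) → ℝ} {g : (κ → ℝ) → ℝ}
    (hf : u =ᵐ[volume.restrict Ω₁.carrier] f) (hg : v =ᵐ[volume.restrict Ω₂.carrier] g) :
    tensor u v =ᵐ[volume.restrict (Ω₁.prod Ω₂).carrier]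
      fun z => f (z ∘ Sum.inl) * g (z ∘ Sum.inr) := by
  filter_upwards [coeFn_tensor u v, (quasiMeasurePreserving_inl Ω₁ Ω₂).ae hf,
    (quasiMeasurePreserving_inr Ω₁ Ω₂).ae hg] with z h1 h2 h3
  rw [h1, h2, h3]

lemma inner_tensor (u u' : L2 Ω₁) (v v' : L2 Ω₂) :
    inner ℝ (tensor u v) (tensor u' v') = inner ℝ u u' * inner ℝ v v' := by
  rw [L2.inner_eq_integral, L2.inner_eq_integral, L2.inner_eq_integral, ← integral_prod_mul,
    ← setIntegral_prod_carrier]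
  refine integral_congr_ae ?_
  filter_upwards [coeFn_tensor u v, coeFn_tensor u' v'] with z h1 h2
  rw [h1, h2]
  ring

lemma norm_tensor (u : L2 Ω₁) (v : L2 Ω₂) : ‖tensor u v‖ = ‖u‖ * ‖v‖ := by
  rw [← sq_eq_sq₀ (norm_nonneg _) (by positivity), mul_pow, ← real_inner_self_eq_norm_sq,
    ← real_inner_self_eq_norm_sq, ← real_inner_self_eq_norm_sq, inner_tensor]

/-- The tensor product as a bounded bilinear map. -/
def tensorL (Ω₁ : Domain ι) (Ω₂ : Domain κ) : L2 Ω₁ →L[ℝ] L2 Ω₂ →L[ℝ] L2 (Ω₁.prod Ω₂) :=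
  LinearMap.mkContinuous₂ (LinearMap.mk₂ ℝ tensor
    (fun u u' v => Lp.ext <| by
      filter_upwards [eq_tensor (Lp.coeFn_add u u') (ae_eq_refl v), Lp.coeFn_add (tensor u v)
        (tensor u' v), coeFn_tensor u v, coeFn_tensor u' v] with z h1 h2 h3 h4
      rw [h1, h2, Pi.add_apply, Pi.add_apply, h3, h4, add_mul])
    (fun c u v => Lp.ext <| by
      filter_upwards [eq_tensor (Lp.coeFn_smul c u) (ae_eq_refl v), Lp.coeFn_smul c (tensor u v),
        coeFn_tensor u v] with z h1 h2 h3
      rw [h1, h2, Pi.smul_apply, Pi.smul_apply, h3, smul_eq_mul, smul_eq_mul, mul_assoc])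
    (fun u v v' => Lp.ext <| by
      filter_upwards [eq_tensor (ae_eq_refl u) (Lp.coeFn_add v v'), Lp.coeFn_add (tensor u v)
        (tensor u v'), coeFn_tensor u v, coeFn_tensor u v'] with z h1 h2 h3 h4
      rw [h1, h2, Pi.add_apply, Pi.add_apply, h3, h4, mul_add])
    (fun c u v => Lp.ext <| by
      filter_upwards [eq_tensor (ae_eq_refl u) (Lp.coeFn_smul c v), Lp.coeFn_smul c (tensor u v),
        coeFn_tensor u v] with z h1 h2 h3
      rw [h1, h2, Pi.smul_apply, Pi.smul_apply, h3, smul_eq_mul, smul_eq_mul, mul_left_comm])) 1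
    fun u v => by simp [norm_tensor]

lemma continuous_tensor : Continuous fun p : L2 Ω₁ × L2 Ω₂ => tensor p.1 p.2 :=
  (tensorL Ω₁ Ω₂).continuous₂

/-- A square integrable function on `Ω₁ × Ω₂` that is orthogonal to all tensor products vanishes:
its integrals over rectangles vanish, and these generate the σ-algebra. -/
lemma eq_zero_of_forall_inner_tensor {f : L2 (Ω₁.prod Ω₂)}
    (h : ∀ (u : L2 Ω₁) (v : L2 Ω₂), inner ℝ (tensor u v) f = 0) : f = 0 := by
  set μ := volume.restrict (Ω₁.prod Ω₂).carrier with hμ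
  have hfin : ∀ {τ : Type} [Fintype τ] (Ω : Domain τ) (s : Set (τ → ℝ)),
      volume.restrict Ω.carrier s ≠ ⊤ := fun Ω s =>
    ((measure_mono (subset_univ s)).trans_lt
      (by rw [Measure.restrict_apply_univ]; exact Ω.isBounded.measure_lt_top)).ne
  have : IsFiniteMeasure μ := ⟨(hfin (Ω₁.prod Ω₂) univ).lt_top⟩
  have hint : Integrable f μ := (Lp.memLp f).integrable (by norm_num)
  have hpre : ∀ {t : Set ((ι → ℝ) × (κ → ℝ))}, MeasurableSet t →
      MeasurableSet (splitEquiv ι κ ⁻¹' t) := fun ht => (splitEquiv ι κ).measurable ht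
  have hbasic : ∀ (s : Set (ι → ℝ)) (t : Set (κ → ℝ)), MeasurableSet s → MeasurableSet t →
      ∫ z in splitEquiv ι κ ⁻¹' (s ×ˢ t), f z ∂μ = 0 := by
    intro s t hs ht
    rw [← h (indicatorConstLp 2 hs (hfin Ω₁ s) 1) (indicatorConstLp 2 ht (hfin Ω₂ t) 1),
      L2.inner_eq_integral, ← integral_indicator (hpre (hs.prod ht))]
    refine integral_congr_ae ?_
    filter_upwards [eq_tensor (Ω₁ := Ω₁) (Ω₂ := Ω₂)
      (indicatorConstLp_coeFn (p := 2) (hs := hs) (hμs := hfin Ω₁ s) (c := (1 : ℝ)))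
      (indicatorConstLp_coeFn (p := 2) (hs := ht) (hμs := hfin Ω₂ t) (c := (1 : ℝ)))] with z hz
    rw [hz]
    by_cases h1 : z ∘ Sum.inl ∈ s
    · by_cases h2 : z ∘ Sum.inr ∈ t
      · rw [indicator_of_mem (show z ∈ splitEquiv ι κ ⁻¹' (s ×ˢ t) from ⟨h1, h2⟩)]
        simp [h1, h2]
      · rw [indicator_of_notMem (fun hz : z ∈ splitEquiv ι κ ⁻¹' (s ×ˢ t) => h2 hz.2)]
        simp [h2]
    · rw [indicator_of_notMem (fun hz : z ∈ splitEquiv ι κ ⁻¹' (s ×ˢ t) => h1 hz.1)]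
      simp [h1]
  have huniv : ∫ z, f z ∂μ = 0 := by
    have := hbasic univ univ .univ .univ
    simpa using this
  have hall : ∀ t (_ : MeasurableSet t), ∫ z in splitEquiv ι κ ⁻¹' t, f z ∂μ = 0 := by
    refine MeasurableSpace.induction_on_inter generateFrom_prod.symm isPiSystem_prod ?_ ?_ ?_ ?_
    · simp
    · rintro _ ⟨s, hs, t, ht, rfl⟩
      exact hbasic s t hs ht
    · intro t ht h0
      have := integral_add_compl (hpre ht) hint
      rw [h0, huniv, zero_add] at this
      exact this
    · intro t hd ht h0
      rw [preimage_iUnion, integral_iUnion (fun i => hpre (ht i))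
        (fun i j hij => (hd hij).preimage _) hint.integrableOn]
      simp [h0]
  rw [Lp.eq_zero_iff_ae_eq_zero]
  refine hint.ae_eq_zero_of_forall_setIntegral_eq_zero fun s hs _ => ?_
  have := hall ((splitEquiv ι κ).symm ⁻¹' s) ((splitEquiv ι κ).symm.measurable hs)
  rwa [← preimage_comp, MeasurableEquiv.symm_comp_self, preimage_id] at this

/-- Tensor products of complete families are complete. -/
lemma eq_zero_of_forall_inner_tensor_of_complete {σ τ : Type*} {a : σ → L2 Ω₁} {b : τ → L2 Ω₂}
    (ha : ∀ f, (∀ j, inner ℝ (a j) f = 0) → f = 0) (hb : ∀ f, (∀ k, inner ℝ (b k) f = 0) → f = 0)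
    {f : L2 (Ω₁.prod Ω₂)} (h : ∀ j k, inner ℝ (tensor (a j) (b k)) f = 0) : f = 0 := by
  -- The adjoint of `u ↦ u ⊗ v` maps `f` to the partial integral of `f` against `v`.
  have h1 : ∀ (u : L2 Ω₁) k, inner ℝ (tensor u (b k)) f = 0 := by
    intro u k
    have h0 : ((tensorL Ω₁ Ω₂).flip (b k)).adjoint f = 0 := ha _ fun j => by
      rw [ContinuousLinearMap.adjoint_inner_right]
      exact h j k
    have := ContinuousLinearMap.adjoint_inner_right ((tensorL Ω₁ Ω₂).flip (b k)) u f
    rw [h0, inner_zero_right] at this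
    exact this.symm
  refine eq_zero_of_forall_inner_tensor fun u v => ?_
  have h0 : (tensorL Ω₁ Ω₂ u).adjoint f = 0 := hb _ fun k => by
    rw [ContinuousLinearMap.adjoint_inner_right]
    exact h1 u k
  have := ContinuousLinearMap.adjoint_inner_right (tensorL Ω₁ Ω₂ u) v f
  rw [h0, inner_zero_right] at this
  exact this.symm

end L2

/-! ### Dyads in `H₀¹(Ω₁ × Ω₂)` -/

lemma pderiv_eq_fderiv {ι : Type} [DecidableEq ι] (φ : (ι → ℝ) → ℝ) (i : ι) (x : ι → ℝ) :
    pderiv φ i x = fderiv ℝ φ x (Pi.single i 1) := by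
  rw [pderiv]
  congr!

/-- The coordinate projection `ℝ^(ι ⊕ κ) → ℝ^ι`. -/
def inlL (ι κ : Type) : (ι ⊕ κ → ℝ) →L[ℝ] (ι → ℝ) :=
  ContinuousLinearMap.pi fun i => ContinuousLinearMap.proj (Sum.inl i)

/-- The coordinate projection `ℝ^(ι ⊕ κ) → ℝ^κ`. -/
def inrL (ι κ : Type) : (ι ⊕ κ → ℝ) →L[ℝ] (κ → ℝ) :=
  ContinuousLinearMap.pi fun k => ContinuousLinearMap.proj (Sum.inr k)

lemma isCompact_prod_preimage {ι κ : Type} {A : Set (ι → ℝ)} {B : Set (κ → ℝ)} (hA : IsCompact A)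
    (hB : IsCompact B) : IsCompact {z : ι ⊕ κ → ℝ | z ∘ Sum.inl ∈ A ∧ z ∘ Sum.inr ∈ B} := by
  have hcont : Continuous fun p : (ι → ℝ) × (κ → ℝ) => (Sum.elim p.1 p.2 : ι ⊕ κ → ℝ) := by
    refine continuous_pi fun s => ?_
    cases s
    · exact (continuous_apply _).comp continuous_fst
    · exact (continuous_apply _).comp continuous_snd
  convert (hA.prod hB).image hcont using 1
  ext z
  constructor
  · rintro ⟨h1, h2⟩
    exact ⟨(z ∘ Sum.inl, z ∘ Sum.inr), ⟨h1, h2⟩, Sum.elim_comp_inl_inr z⟩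
  · rintro ⟨p, ⟨h1, h2⟩, rfl⟩
    exact ⟨by simpa using h1, by simpa using h2⟩

lemma IsTestFunction.tensor {φ : (ι → ℝ) → ℝ} {ψ : (κ → ℝ) → ℝ} (hφ : IsTestFunction Ω₁ φ)
    (hψ : IsTestFunction Ω₂ ψ) :
    IsTestFunction (Ω₁.prod Ω₂) fun z => φ (z ∘ Sum.inl) * ψ (z ∘ Sum.inr) := by
  set S : Set (ι ⊕ κ → ℝ) := {z | z ∘ Sum.inl ∈ tsupport φ ∧ z ∘ Sum.inr ∈ tsupport ψ} with hS
  have hSc : IsCompact S := isCompact_prod_preimage hφ.compact.isCompact hψ.compact.isCompact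
  have h0 : ∀ z, z ∉ S → φ (z ∘ Sum.inl) * ψ (z ∘ Sum.inr) = 0 := by
    intro z hz
    by_cases h1 : z ∘ Sum.inl ∈ tsupport φ
    · rw [image_eq_zero_of_notMem_tsupport fun h2 => hz ⟨h1, h2⟩, mul_zero]
    · rw [image_eq_zero_of_notMem_tsupport h1, zero_mul]
  refine ⟨?_, HasCompactSupport.intro hSc h0, ?_⟩
  · exact (hφ.smooth.comp (inlL ι κ).contDiff).mul (hψ.smooth.comp (inrL ι κ).contDiff)
  · refine (closure_minimal (fun z hz => ?_) hSc.isClosed).trans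
      fun z hz => ⟨hφ.subset hz.1, hψ.subset hz.2⟩
    by_contra hzS
    exact hz (h0 z hzS)

lemma hasFDerivAt_tensor {φ : (ι → ℝ) → ℝ} {ψ : (κ → ℝ) → ℝ} (hφ : ContDiff ℝ ∞ φ)
    (hψ : ContDiff ℝ ∞ ψ) (z : ι ⊕ κ → ℝ) :
    HasFDerivAt (fun z : ι ⊕ κ → ℝ => φ (z ∘ Sum.inl) * ψ (z ∘ Sum.inr))
      (φ (z ∘ Sum.inl) • (fderiv ℝ ψ (z ∘ Sum.inr)).comp (inrL ι κ) +
        ψ (z ∘ Sum.inr) • (fderiv ℝ φ (z ∘ Sum.inl)).comp (inlL ι κ)) z := by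
  have h1 : HasFDerivAt (fun z : ι ⊕ κ → ℝ => φ (inlL ι κ z))
      ((fderiv ℝ φ (z ∘ Sum.inl)).comp (inlL ι κ)) z :=
    ((hφ.differentiable (by simp)) (inlL ι κ z)).hasFDerivAt.comp z (inlL ι κ).hasFDerivAt
  have h2 : HasFDerivAt (fun z : ι ⊕ κ → ℝ => ψ (inrL ι κ z))
      ((fderiv ℝ ψ (z ∘ Sum.inr)).comp (inrL ι κ)) z :=
    ((hψ.differentiable (by simp)) (inrL ι κ z)).hasFDerivAt.comp z (inrL ι κ).hasFDerivAt
  exact h1.mul h2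

lemma pderiv_tensor_inl {φ : (ι → ℝ) → ℝ} {ψ : (κ → ℝ) → ℝ} (hφ : ContDiff ℝ ∞ φ)
    (hψ : ContDiff ℝ ∞ ψ) (i : ι) (z : ι ⊕ κ → ℝ) :
    pderiv (fun z : ι ⊕ κ → ℝ => φ (z ∘ Sum.inl) * ψ (z ∘ Sum.inr)) (Sum.inl i) z =
      pderiv φ i (z ∘ Sum.inl) * ψ (z ∘ Sum.inr) := by
  classical
  have h1 : inlL ι κ (Pi.single (Sum.inl i) 1) = Pi.single i 1 := by
    ext j; simp [inlL, Pi.single_apply]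
  have h2 : inrL ι κ (Pi.single (Sum.inl i) 1) = 0 := by
    ext j; simp [inrL]
  rw [pderiv_eq_fderiv, pderiv_eq_fderiv φ, (hasFDerivAt_tensor hφ hψ z).fderiv]
  simp [h1, h2, mul_comm]

lemma pderiv_tensor_inr {φ : (ι → ℝ) → ℝ} {ψ : (κ → ℝ) → ℝ} (hφ : ContDiff ℝ ∞ φ)
    (hψ : ContDiff ℝ ∞ ψ) (k : κ) (z : ι ⊕ κ → ℝ) :
    pderiv (fun z : ι ⊕ κ → ℝ => φ (z ∘ Sum.inl) * ψ (z ∘ Sum.inr)) (Sum.inr k) z =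
      φ (z ∘ Sum.inl) * pderiv ψ k (z ∘ Sum.inr) := by
  classical
  have h1 : inrL ι κ (Pi.single (Sum.inr k) 1) = Pi.single k 1 := by
    ext j; simp [inrL, Pi.single_apply]
  have h2 : inlL ι κ (Pi.single (Sum.inr k) 1) = 0 := by
    ext j; simp [inlL]
  rw [pderiv_eq_fderiv, pderiv_eq_fderiv ψ, (hasFDerivAt_tensor hφ hψ z).fderiv]
  simp [h1, h2]

namespace H01

/-- The tensor product on graphs: `(u, ∇u), (v, ∇v) ↦ (u ⊗ v, (∇u ⊗ v, u ⊗ ∇v))`. -/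
def tensorGraph (p : L2 Ω₁ × (ι → L2 Ω₁)) (q : L2 Ω₂ × (κ → L2 Ω₂)) :
    L2 (Ω₁.prod Ω₂) × (ι ⊕ κ → L2 (Ω₁.prod Ω₂)) :=
  (L2.tensor p.1 q.1, Sum.elim (fun i => L2.tensor (p.2 i) q.1) fun k => L2.tensor p.1 (q.2 k))

lemma continuous_tensorGraph :
    Continuous (Function.uncurry (tensorGraph (Ω₁ := Ω₁) (Ω₂ := Ω₂))) := by
  refine (L2.continuous_tensor.comp (by fun_prop : Continuous fun x :
    (L2 Ω₁ × (ι → L2 Ω₁)) × (L2 Ω₂ × (κ → L2 Ω₂)) => (x.1.1, x.2.1))).prodMk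
    (continuous_pi fun s => ?_)
  cases s with
  | inl i => exact L2.continuous_tensor.comp (by fun_prop : Continuous fun x :
      (L2 Ω₁ × (ι → L2 Ω₁)) × (L2 Ω₂ × (κ → L2 Ω₂)) => (x.1.2 i, x.2.1))
  | inr k => exact L2.continuous_tensor.comp (by fun_prop : Continuous fun x :
      (L2 Ω₁ × (ι → L2 Ω₁)) × (L2 Ω₂ × (κ → L2 Ω₂)) => (x.1.1, x.2.2 k))

lemma tensorGraph_mem_testGraph {p : L2 Ω₁ × (ι → L2 Ω₁)} {q : L2 Ω₂ × (κ → L2 Ω₂)}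
    (hp : p ∈ testGraph Ω₁) (hq : q ∈ testGraph Ω₂) :
    tensorGraph p q ∈ testGraph (Ω₁.prod Ω₂) := by
  obtain ⟨φ, hφ, hp1, hp2⟩ := hp
  obtain ⟨ψ, hψ, hq1, hq2⟩ := hq
  refine ⟨_, hφ.tensor hψ, L2.eq_tensor hp1 hq1, ?_⟩
  rintro (i | k)
  · filter_upwards [L2.eq_tensor (hp2 i) hq1] with z hz
    rw [pderiv_tensor_inl hφ.smooth hψ.smooth]
    exact hz
  · filter_upwards [L2.eq_tensor hp1 (hq2 k)] with z hz
    rw [pderiv_tensor_inr hφ.smooth hψ.smooth]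
    exact hz

/-- The dyad `u ⊗ v` as an element of `H₀¹(Ω₁ × Ω₂)`. -/
def tensor (u : H01 Ω₁) (v : H01 Ω₂) : H01 (Ω₁.prod Ω₂) :=
  ⟨tensorGraph u.1 v.1, map_mem_closure₂ continuous_tensorGraph u.2 v.2
    fun _ hp _ hq => tensorGraph_mem_testGraph hp hq⟩

@[simp] lemma toL2_tensor (u : H01 Ω₁) (v : H01 Ω₂) :
    (tensor u v).toL2 = L2.tensor u.toL2 v.toL2 := rfl

@[simp] lemma wderiv_inl_tensor (u : H01 Ω₁) (v : H01 Ω₂) (i : ι) :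
    (tensor u v).wderiv (Sum.inl i) = L2.tensor (u.wderiv i) v.toL2 := rfl

@[simp] lemma wderiv_inr_tensor (u : H01 Ω₁) (v : H01 Ω₂) (k : κ) :
    (tensor u v).wderiv (Sum.inr k) = L2.tensor u.toL2 (v.wderiv k) := rfl

lemma isDyad_iff {u : H01 Ω₁} {v : H01 Ω₂} {w : H01 (Ω₁.prod Ω₂)} :
    IsDyad u v w ↔ w = tensor u v := by
  constructor
  · intro h
    refine toL2_injective (Lp.ext ?_)
    rw [toL2_tensor]
    exact h.trans (L2.coeFn_tensor _ _).symm
  · rintro rfl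
    exact L2.coeFn_tensor _ _

end H01

/-! ### Tensor products of eigenfunctions -/

lemma contDiff_sumElim {ι κ : Type} [Fintype ι] [Fintype κ] (y : κ → ℝ) :
    ContDiff ℝ ∞ fun x : ι → ℝ => (Sum.elim x y : ι ⊕ κ → ℝ) := by
  refine contDiff_pi.2 fun s => ?_
  cases s with
  | inl i => exact contDiff_apply ℝ ℝ i
  | inr k => exact contDiff_const

lemma contDiff_sumElim_right {ι κ : Type} [Fintype ι] [Fintype κ] (x : ι → ℝ) :
    ContDiff ℝ ∞ fun y : κ → ℝ => (Sum.elim x y : ι ⊕ κ → ℝ) := by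
  refine contDiff_pi.2 fun s => ?_
  cases s with
  | inl i => exact contDiff_const
  | inr k => exact contDiff_apply ℝ ℝ k

lemma IsTestFunction.slice_left {θ : (ι ⊕ κ → ℝ) → ℝ} (hθ : IsTestFunction (Ω₁.prod Ω₂) θ)
    (y : κ → ℝ) : IsTestFunction Ω₁ fun x => θ (Sum.elim x y) := by
  have hS : IsCompact (inlL ι κ '' tsupport θ) := hθ.compact.isCompact.image (inlL ι κ).continuous
  have h0 : ∀ x, x ∉ inlL ι κ '' tsupport θ → θ (Sum.elim x y) = 0 := fun x hx =>
    image_eq_zero_of_notMem_tsupport fun h => hx ⟨_, h, Sum.elim_comp_inl x y⟩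
  refine ⟨hθ.smooth.comp (contDiff_sumElim y), HasCompactSupport.intro hS h0, ?_⟩
  refine (closure_minimal (fun x hx => ?_) hS.isClosed).trans ?_
  · by_contra hxS
    exact hx (h0 x hxS)
  · rintro _ ⟨z, hz, rfl⟩
    exact (hθ.subset hz).1

lemma IsTestFunction.slice_right {θ : (ι ⊕ κ → ℝ) → ℝ} (hθ : IsTestFunction (Ω₁.prod Ω₂) θ)
    (x : ι → ℝ) : IsTestFunction Ω₂ fun y => θ (Sum.elim x y) := by
  have hS : IsCompact (inrL ι κ '' tsupport θ) := hθ.compact.isCompact.image (inrL ι κ).continuous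
  have h0 : ∀ y, y ∉ inrL ι κ '' tsupport θ → θ (Sum.elim x y) = 0 := fun y hy =>
    image_eq_zero_of_notMem_tsupport fun h => hy ⟨_, h, Sum.elim_comp_inr x y⟩
  refine ⟨hθ.smooth.comp (contDiff_sumElim_right x), HasCompactSupport.intro hS h0, ?_⟩
  refine (closure_minimal (fun y hy => ?_) hS.isClosed).trans ?_
  · by_contra hyS
    exact hy (h0 y hyS)
  · rintro _ ⟨z, hz, rfl⟩
    exact (hθ.subset hz).2

lemma pderiv_slice_left {θ : (ι ⊕ κ → ℝ) → ℝ} (hθ : ContDiff ℝ ∞ θ) (y : κ → ℝ) (i : ι)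
    (x : ι → ℝ) :
    pderiv (fun x => θ (Sum.elim x y)) i x = pderiv θ (Sum.inl i) (Sum.elim x y) := by
  classical
  have h1 : HasDerivAt (fun t : ℝ => (Sum.elim (x + t • Pi.single i 1) y : ι ⊕ κ → ℝ))
      (Pi.single (Sum.inl i) 1) 0 := by
    refine hasDerivAt_pi.2 fun s => ?_
    rcases s with j | k
    · simpa [Pi.single_apply] using
        ((hasDerivAt_id (0 : ℝ)).mul_const ((Pi.single i 1 : ι → ℝ) j)).const_add (x j)
    · simpa using hasDerivAt_const (0 : ℝ) (y k)
  have h2 : HasDerivAt (fun t : ℝ => x + t • (Pi.single i 1 : ι → ℝ)) (Pi.single i 1) 0 := by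
    simpa using ((hasDerivAt_id (0 : ℝ)).smul_const (Pi.single i (1 : ℝ))).const_add x
  have e0 : x + (0 : ℝ) • (Pi.single i 1 : ι → ℝ) = x := by simp
  have e1 := ((hθ.differentiable (by simp))
    (Sum.elim (x + (0 : ℝ) • Pi.single i 1) y)).hasFDerivAt.comp_hasDerivAt (0 : ℝ) h1
  have e2 := (((hθ.comp (contDiff_sumElim y)).differentiable (by simp))
    (x + (0 : ℝ) • Pi.single i 1)).hasFDerivAt.comp_hasDerivAt (0 : ℝ) h2
  have := e2.unique e1
  rw [e0] at this
  rw [pderiv_eq_fderiv, pderiv_eq_fderiv]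
  exact this

lemma pderiv_slice_right {θ : (ι ⊕ κ → ℝ) → ℝ} (hθ : ContDiff ℝ ∞ θ) (x : ι → ℝ) (k : κ)
    (y : κ → ℝ) :
    pderiv (fun y => θ (Sum.elim x y)) k y = pderiv θ (Sum.inr k) (Sum.elim x y) := by
  classical
  have h1 : HasDerivAt (fun t : ℝ => (Sum.elim x (y + t • Pi.single k 1) : ι ⊕ κ → ℝ))
      (Pi.single (Sum.inr k) 1) 0 := by
    refine hasDerivAt_pi.2 fun s => ?_
    rcases s with j | j
    · simpa using hasDerivAt_const (0 : ℝ) (x j)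
    · simpa [Pi.single_apply] using
        ((hasDerivAt_id (0 : ℝ)).mul_const ((Pi.single k 1 : κ → ℝ) j)).const_add (y j)
  have h2 : HasDerivAt (fun t : ℝ => y + t • (Pi.single k 1 : κ → ℝ)) (Pi.single k 1) 0 := by
    simpa using ((hasDerivAt_id (0 : ℝ)).smul_const (Pi.single k (1 : ℝ))).const_add y
  have e0 : y + (0 : ℝ) • (Pi.single k 1 : κ → ℝ) = y := by simp
  have e1 := ((hθ.differentiable (by simp))
    (Sum.elim x (y + (0 : ℝ) • Pi.single k 1))).hasFDerivAt.comp_hasDerivAt (0 : ℝ) h1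
  have e2 := (((hθ.comp (contDiff_sumElim_right x)).differentiable (by simp))
    (y + (0 : ℝ) • Pi.single k 1)).hasFDerivAt.comp_hasDerivAt (0 : ℝ) h2
  have := e2.unique e1
  rw [e0] at this
  rw [pderiv_eq_fderiv, pderiv_eq_fderiv]
  exact this

section Fubini

variable (f : L2 Ω₁) (g : L2 Ω₂) {F : (ι ⊕ κ → ℝ) → ℝ}

lemma integrable_tensor_mul (hF : MemLp F 2 (volume.restrict (Ω₁.prod Ω₂).carrier)) :
    Integrable (fun p : (ι → ℝ) × (κ → ℝ) => f p.1 * g p.2 * F (Sum.elim p.1 p.2))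
      ((volume.restrict Ω₁.carrier).prod (volume.restrict Ω₂.carrier)) := by
  rw [← integrable_splitEquiv_iff]
  simp only [Sum.elim_comp_inl_inr]
  exact (memLp_tensor (Lp.memLp f) (Lp.memLp g)).integrable_mul hF

lemma integral_tensor_mul :
    ∫ z in (Ω₁.prod Ω₂).carrier, L2.tensor f g z * F z =
      ∫ p, f p.1 * g p.2 * F (Sum.elim p.1 p.2)
        ∂((volume.restrict Ω₁.carrier).prod (volume.restrict Ω₂.carrier)) := by
  rw [← setIntegral_prod_carrier]
  refine integral_congr_ae ?_
  filter_upwards [L2.coeFn_tensor f g] with z hz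
  rw [hz, Sum.elim_comp_inl_inr]

lemma integrable_mul_integral_left (hF : MemLp F 2 (volume.restrict (Ω₁.prod Ω₂).carrier)) :
    Integrable (fun y => g y * ∫ x in Ω₁.carrier, f x * F (Sum.elim x y))
      (volume.restrict Ω₂.carrier) := by
  refine (integrable_tensor_mul f g hF).integral_prod_right.congr (ae_of_all _ fun y => ?_)
  simp only [← integral_const_mul]
  congr 1; ext x; ring

lemma integrable_mul_integral_right (hF : MemLp F 2 (volume.restrict (Ω₁.prod Ω₂).carrier)) :
    Integrable (fun x => f x * ∫ y in Ω₂.carrier, g y * F (Sum.elim x y))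
      (volume.restrict Ω₁.carrier) := by
  refine (integrable_tensor_mul f g hF).integral_prod_left.congr (ae_of_all _ fun x => ?_)
  simp only [← integral_const_mul]
  congr 1; ext y; ring

lemma integral_tensor_mul_left (hF : MemLp F 2 (volume.restrict (Ω₁.prod Ω₂).carrier)) :
    ∫ z in (Ω₁.prod Ω₂).carrier, L2.tensor f g z * F z =
      ∫ y in Ω₂.carrier, g y * ∫ x in Ω₁.carrier, f x * F (Sum.elim x y) := by
  rw [integral_tensor_mul, integral_prod_symm _ (integrable_tensor_mul f g hF)]
  congr 1; ext y
  rw [← integral_const_mul]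
  congr 1; ext x; ring

lemma integral_tensor_mul_right (hF : MemLp F 2 (volume.restrict (Ω₁.prod Ω₂).carrier)) :
    ∫ z in (Ω₁.prod Ω₂).carrier, L2.tensor f g z * F z =
      ∫ x in Ω₁.carrier, f x * ∫ y in Ω₂.carrier, g y * F (Sum.elim x y) := by
  rw [integral_tensor_mul, integral_prod _ (integrable_tensor_mul f g hF)]
  congr 1; ext x
  rw [← integral_const_mul]
  congr 1; ext y; ring

end Fubini

lemma IsDirichletEigenpair.sum_integral_test {Ω : Domain ι} {μ : ℝ} {u : H01 Ω}
    (hu : IsDirichletEigenpair Ω μ u) {ψ : (ι → ℝ) → ℝ} (hψ : IsTestFunction Ω ψ) :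
    ∑ i, ∫ x in Ω.carrier, u.wderiv i x * pderiv ψ i x =
      μ * ∫ x in Ω.carrier, u.toL2 x * ψ x := by
  obtain ⟨h, h1, h2⟩ := exists_of_test hψ
  have e1 : ∫ x in Ω.carrier, u.toL2 x * ψ x = l2Inner u h :=
    integral_congr_ae (by filter_upwards [h1] with x hx; rw [hx])
  have e2 : ∑ i, ∫ x in Ω.carrier, u.wderiv i x * pderiv ψ i x = gradInner u h :=
    Finset.sum_congr rfl fun i _ =>
      integral_congr_ae (by filter_upwards [h2 i] with x hx; rw [hx])
  rw [e1, e2, hu.2]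

/-- The eigenvalue equation in the first variables, integrated over the second ones. -/
lemma IsDirichletEigenpair.sum_integral_tensor_left {μ : ℝ} {u : H01 Ω₁}
    (hu : IsDirichletEigenpair Ω₁ μ u) (v : L2 Ω₂) {θ : (ι ⊕ κ → ℝ) → ℝ}
    (hθ : IsTestFunction (Ω₁.prod Ω₂) θ) :
    ∑ i, ∫ z in (Ω₁.prod Ω₂).carrier, L2.tensor (u.wderiv i) v z * pderiv θ (Sum.inl i) z =
      μ * ∫ z in (Ω₁.prod Ω₂).carrier, L2.tensor u.toL2 v z * θ z := by
  rw [integral_tensor_mul_left _ _ hθ.memLp]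
  simp_rw [integral_tensor_mul_left _ _ (hθ.memLp_pderiv _)]
  rw [← integral_finsetSum _ fun i _ => integrable_mul_integral_left _ _ (hθ.memLp_pderiv _),
    ← integral_const_mul]
  congr 1; ext y
  rw [← Finset.mul_sum, mul_left_comm, ← hu.sum_integral_test (hθ.slice_left y)]
  simp_rw [pderiv_slice_left hθ.smooth]

/-- The eigenvalue equation in the second variables, integrated over the first ones. -/
lemma IsDirichletEigenpair.sum_integral_tensor_right {μ : ℝ} {v : H01 Ω₂}
    (hv : IsDirichletEigenpair Ω₂ μ v) (u : L2 Ω₁) {θ : (ι ⊕ κ → ℝ) → ℝ}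
    (hθ : IsTestFunction (Ω₁.prod Ω₂) θ) :
    ∑ k, ∫ z in (Ω₁.prod Ω₂).carrier, L2.tensor u (v.wderiv k) z * pderiv θ (Sum.inr k) z =
      μ * ∫ z in (Ω₁.prod Ω₂).carrier, L2.tensor u v.toL2 z * θ z := by
  rw [integral_tensor_mul_right _ _ hθ.memLp]
  simp_rw [integral_tensor_mul_right _ _ (hθ.memLp_pderiv _)]
  rw [← integral_finsetSum _ fun i _ => integrable_mul_integral_right _ _ (hθ.memLp_pderiv _),
    ← integral_const_mul]
  congr 1; ext x
  rw [← Finset.mul_sum, mul_left_comm, ← hv.sum_integral_test (hθ.slice_right x)]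
  simp_rw [pderiv_slice_right hθ.smooth]

/-- Separation of variables: the tensor product of two eigenfunctions is an eigenfunction for the
sum of the eigenvalues. -/
theorem IsDirichletEigenpair.tensor [Nonempty ι] {μ ν : ℝ} {u : H01 Ω₁} {v : H01 Ω₂}
    (hu : IsDirichletEigenpair Ω₁ μ u) (hv : IsDirichletEigenpair Ω₂ ν v) :
    IsDirichletEigenpair (Ω₁.prod Ω₂) (μ + ν) (tensor u v) := by
  constructor
  · intro h0
    have h1 : ‖L2.tensor u.toL2 v.toL2‖ = 0 := by
      rw [← toL2_tensor, h0, map_zero, norm_zero]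
    rw [L2.norm_tensor, mul_eq_zero, norm_eq_zero, norm_eq_zero] at h1
    exact h1.elim (fun h => hu.1 (toL2_injective (h.trans (map_zero _).symm)))
      fun h => hv.1 (toL2_injective (h.trans (map_zero _).symm))
  intro h
  have hcl : IsClosed {p : L2 (Ω₁.prod Ω₂) × (ι ⊕ κ → L2 (Ω₁.prod Ω₂)) |
      ∑ s, inner ℝ ((H01.tensor u v).wderiv s) (p.2 s) =
        (μ + ν) * inner ℝ (H01.tensor u v).toL2 p.1} :=
    isClosed_eq (by fun_prop) (by fun_prop)
  rw [gradInner_eq, l2Inner_eq]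
  refine mem_of_isClosed hcl ?_ h
  rintro p ⟨θ, hθ, hp, hp'⟩
  have e1 : ∀ f : L2 (Ω₁.prod Ω₂),
      inner ℝ f p.1 = ∫ z in (Ω₁.prod Ω₂).carrier, f z * θ z := fun f => by
    rw [L2.inner_eq_integral]
    exact integral_congr_ae (by filter_upwards [hp] with z hz; rw [hz])
  have e2 : ∀ (f : L2 (Ω₁.prod Ω₂)) s,
      inner ℝ f (p.2 s) = ∫ z in (Ω₁.prod Ω₂).carrier, f z * pderiv θ s z := fun f s => by
    rw [L2.inner_eq_integral]
    exact integral_congr_ae (by filter_upwards [hp' s] with z hz; rw [hz])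
  simp only [mem_ofPred_eq, e1, e2, Fintype.sum_sum_type, toL2_tensor, wderiv_inl_tensor,
    wderiv_inr_tensor]
  rw [hu.sum_integral_tensor_left _ hθ, hv.sum_integral_tensor_right _ hθ, add_mul]

/-! ### The spectral decomposition of the product -/

section Product

variable [Nonempty ι] [Nonempty κ] {lam₁ lam₂ : ℕ → ℝ} {e₁ : ℕ → H01 Ω₁} {e₂ : ℕ → H01 Ω₂}

/-- The products of eigenfunctions are complete in `L²(Ω₁ × Ω₂)`. -/
lemma eq_zero_of_forall_l2Inner_tensor (h₁ : IsDirichletEigensystem Ω₁ lam₁ e₁)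
    (h₂ : IsDirichletEigensystem Ω₂ lam₂ e₂) {w : H01 (Ω₁.prod Ω₂)}
    (hw : ∀ j k, l2Inner (tensor (e₁ j) (e₂ k)) w = 0) : w = 0 := by
  refine toL2_injective (Eq.trans ?_ (map_zero _).symm)
  refine L2.eq_zero_of_forall_inner_tensor_of_complete
    (fun f hf => h₁.eq_zero_of_forall_inner_toL2 hf)
    (fun f hf => h₂.eq_zero_of_forall_inner_toL2 hf) fun j k => ?_
  rw [← hw j k, l2Inner_eq, toL2_tensor]

theorem isDirichletEigenvalue_prod_iff (h₁ : IsDirichletEigensystem Ω₁ lam₁ e₁)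
    (h₂ : IsDirichletEigensystem Ω₂ lam₂ e₂) (μ : ℝ) :
    IsDirichletEigenvalue (Ω₁.prod Ω₂) μ ↔ ∃ j k, μ = lam₁ j + lam₂ k := by
  constructor
  · rintro ⟨w, hw⟩
    by_contra! hμ
    refine hw.1 (eq_zero_of_forall_l2Inner_tensor h₁ h₂ fun j k => ?_)
    -- Eigenfunctions with different eigenvalues are orthogonal in `L²`.
    have hjk := (h₁.eigenpair j).tensor (h₂.eigenpair k)
    have e1 := inner_eq_of_eigenpair hw (tensor (e₁ j) (e₂ k))
    have e2 := inner_eq_of_eigenpair hjk w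
    rw [real_inner_comm, e2, real_inner_comm, ← sub_eq_zero, ← sub_mul, mul_eq_zero,
      sub_eq_zero] at e1
    rw [l2Inner_eq, real_inner_comm]
    exact e1.resolve_left fun h => hμ j k h.symm
  · rintro ⟨j, k, rfl⟩
    exact ⟨_, (h₁.eigenpair j).tensor (h₂.eigenpair k)⟩

lemma inner_tensor_eq (h₁ : IsDirichletEigensystem Ω₁ lam₁ e₁)
    (h₂ : IsDirichletEigensystem Ω₂ lam₂ e₂) (j k j' k' : ℕ) :
    inner ℝ (tensor (e₁ j) (e₂ k)) (tensor (e₁ j') (e₂ k')) =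
      if (j, k) = (j', k') then lam₁ j + lam₂ k else 0 := by
  rw [inner_eq_of_eigenpair ((h₁.eigenpair j).tensor (h₂.eigenpair k)), toL2_tensor, toL2_tensor,
    L2.inner_tensor, ← l2Inner_eq, ← l2Inner_eq, h₁.orthonormal, h₂.orthonormal]
  by_cases hj : j = j' <;> by_cases hk : k = k' <;> simp [hj, hk]

/-- The functions `(λ₁ⱼ + λ₂ₖ)^(-1/2) e₁ⱼ ⊗ e₂ₖ` are orthonormal in `H₀¹(Ω₁ × Ω₂)`. -/
lemma orthonormal_tensor (h₁ : IsDirichletEigensystem Ω₁ lam₁ e₁)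
    (h₂ : IsDirichletEigensystem Ω₂ lam₂ e₂) :
    Orthonormal ℝ fun p : ℕ × ℕ => (√(lam₁ p.1 + lam₂ p.2))⁻¹ • tensor (e₁ p.1) (e₂ p.2) := by
  rw [orthonormal_iff_ite]
  rintro ⟨j, k⟩ ⟨j', k'⟩
  rw [real_inner_smul_left, real_inner_smul_right, inner_tensor_eq h₁ h₂]
  split_ifs with h
  · obtain ⟨rfl, rfl⟩ := Prod.ext_iff.1 h
    have hpos : 0 < lam₁ j + lam₂ k := add_pos (h₁.lam_pos j) (h₂.lam_pos k)
    have hs := Real.mul_self_sqrt hpos.le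
    have : √(lam₁ j + lam₂ k) ≠ 0 := (Real.sqrt_pos.2 hpos).ne'
    field_simp
    nlinarith
  · ring

lemma orthogonal_span_tensor_eq_bot (h₁ : IsDirichletEigensystem Ω₁ lam₁ e₁)
    (h₂ : IsDirichletEigensystem Ω₂ lam₂ e₂) :
    (Submodule.span ℝ (range fun p : ℕ × ℕ =>
      (√(lam₁ p.1 + lam₂ p.2))⁻¹ • tensor (e₁ p.1) (e₂ p.2)))ᗮ = ⊥ := by
  refine (Submodule.eq_bot_iff _).2 fun w hw => ?_
  refine eq_zero_of_forall_l2Inner_tensor h₁ h₂ fun j k => ?_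
  have hpos : 0 < lam₁ j + lam₂ k := add_pos (h₁.lam_pos j) (h₂.lam_pos k)
  have h0 := (Submodule.mem_orthogonal _ _).1 hw _ (Submodule.subset_span ⟨(j, k), rfl⟩)
  rw [real_inner_smul_left,
    inner_eq_of_eigenpair ((h₁.eigenpair j).tensor (h₂.eigenpair k)), ← l2Inner_eq] at h0
  have hs : √(lam₁ j + lam₂ k) ≠ 0 := (Real.sqrt_pos.2 hpos).ne'
  simpa [hpos.ne', hs] using h0

theorem dense_span_dyads (h₁ : IsDirichletEigensystem Ω₁ lam₁ e₁)
    (h₂ : IsDirichletEigensystem Ω₂ lam₂ e₂) :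
    Dense (Submodule.span ℝ {w : H01 (Ω₁.prod Ω₂) | ∃ u v, IsDyad u v w} :
      Set (H01 (Ω₁.prod Ω₂))) := by
  rw [Submodule.dense_iff_topologicalClosure_eq_top, Submodule.topologicalClosure_eq_top_iff,
    eq_bot_iff, ← orthogonal_span_tensor_eq_bot h₁ h₂]
  refine Submodule.orthogonal_le (Submodule.span_le.2 ?_)
  rintro _ ⟨p, rfl⟩
  exact Submodule.smul_mem _ _ (Submodule.subset_span ⟨_, _, isDyad_iff.2 rfl⟩)

end Product

/-! ### The Hilbert tensor product -/

section HilbertTensor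

variable {E F : Type} [NormedAddCommGroup E] [InnerProductSpace ℝ E] [NormedAddCommGroup F]
  [InnerProductSpace ℝ F]

lemma inner_pureTensor (a c : E) (b d : F) :
    inner ℝ (pureTensor a b) (pureTensor c d) = inner ℝ a c * inner ℝ b d := by
  rw [pureTensor, pureTensor, UniformSpace.Completion.inner_coe, TensorProduct.inner_tmul]

/-- The map `(a, b) ↦ a ⊗ b` as a bounded bilinear map into the Hilbert tensor product. -/
def pureTensorL (E F : Type) [NormedAddCommGroup E] [InnerProductSpace ℝ E]
    [NormedAddCommGroup F] [InnerProductSpace ℝ F] : E →L[ℝ] F →L[ℝ] HilbertTensor E F :=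
  (ContinuousLinearMap.compL ℝ F (E ⊗[ℝ] F) (HilbertTensor E F)
    UniformSpace.Completion.toComplL).comp (TensorProduct.mkL ℝ E F)

/-- A vector of the Hilbert tensor product that is orthogonal to all pure tensors vanishes. -/
lemma eq_zero_of_forall_inner_pureTensor {x : HilbertTensor E F}
    (h : ∀ a b, inner ℝ (pureTensor a b) x = 0) : x = 0 := by
  have h1 : ∀ t : E ⊗[ℝ] F, inner ℝ (t : HilbertTensor E F) x = 0 := by
    intro t
    induction t using TensorProduct.induction_on with
    | zero => rw [UniformSpace.Completion.coe_zero, inner_zero_left]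
    | tmul a b => exact h a b
    | add s t hs ht => rw [UniformSpace.Completion.coe_add, inner_add_left, hs, ht, add_zero]
  rw [← inner_self_eq_zero (𝕜 := ℝ)]
  exact UniformSpace.Completion.induction_on (p := fun y : HilbertTensor E F => inner ℝ y x = 0) x
    (isClosed_eq (by fun_prop) continuous_const) h1

/-- Pure tensors of orthonormal families are orthonormal. -/
lemma orthonormal_pureTensor {σ τ : Type*} {f : σ → E} {g : τ → F} (hf : Orthonormal ℝ f)
    (hg : Orthonormal ℝ g) : Orthonormal ℝ fun p : σ × τ => pureTensor (f p.1) (g p.2) := by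
  classical
  rw [orthonormal_iff_ite]
  rintro ⟨j, k⟩ ⟨j', k'⟩
  rw [inner_pureTensor, orthonormal_iff_ite.1 hf, orthonormal_iff_ite.1 hg]
  by_cases hj : j = j' <;> by_cases hk : k = k' <;> simp [hj, hk]

/-- Pure tensors of total families are total. -/
lemma orthogonal_span_pureTensor_eq_bot {σ τ : Type*} {f : σ → E} {g : τ → F}
    (hf : Dense (Submodule.span ℝ (range f) : Set E))
    (hg : Dense (Submodule.span ℝ (range g) : Set F)) :
    (Submodule.span ℝ (range fun p : σ × τ => pureTensor (f p.1) (g p.2)))ᗮ = ⊥ := by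
  refine (Submodule.eq_bot_iff _).2 fun x hx => eq_zero_of_forall_inner_pureTensor fun a b => ?_
  have h0 : ∀ j k, inner ℝ x (pureTensor (f j) (g k)) = 0 := fun j k => by
    rw [real_inner_comm]
    exact (Submodule.mem_orthogonal _ _).1 hx _ (Submodule.subset_span ⟨(j, k), rfl⟩)
  have h1 : ∀ a k, inner ℝ x (pureTensor a (g k)) = 0 := fun a k => by
    have : (innerSL ℝ x).comp ((pureTensorL E F).flip (g k)) = 0 :=
      ContinuousLinearMap.ext_on hf (by rintro _ ⟨j, rfl⟩; exact h0 j k)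
    exact DFunLike.congr_fun this a
  have : (innerSL ℝ x).comp (pureTensorL E F a) = 0 :=
    ContinuousLinearMap.ext_on hg (by rintro _ ⟨k, rfl⟩; exact h1 a k)
  rw [real_inner_comm]
  exact DFunLike.congr_fun this b

/-- Two orthonormal bases with the same index set are matched by an isometric isomorphism. -/
lemma exists_linearIsometryEquiv_of_orthonormal {σ G H : Type*} [NormedAddCommGroup G]
    [InnerProductSpace ℝ G] [CompleteSpace G] [NormedAddCommGroup H] [InnerProductSpace ℝ H]
    [CompleteSpace H] {v : σ → G} {w : σ → H} (hv : Orthonormal ℝ v)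
    (hv' : (Submodule.span ℝ (range v))ᗮ = ⊥) (hw : Orthonormal ℝ w)
    (hw' : (Submodule.span ℝ (range w))ᗮ = ⊥) : ∃ Φ : G ≃ₗᵢ[ℝ] H, ∀ s, Φ (v s) = w s := by
  classical
  let b := HilbertBasis.mkOfOrthogonalEqBot hv hv'
  let c := HilbertBasis.mkOfOrthogonalEqBot hw hw'
  refine ⟨b.repr.trans c.repr.symm, fun s => ?_⟩
  have hb : b s = v s := congrFun (HilbertBasis.coe_mkOfOrthogonalEqBot hv hv') s
  have hc : c s = w s := congrFun (HilbertBasis.coe_mkOfOrthogonalEqBot hw hw') s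
  rw [← hb, ← hc, LinearIsometryEquiv.trans_apply, b.repr_self, c.repr_symm_single]

/-- An orthonormal basis indexed by pairs identifies a Hilbert space with a Hilbert tensor
product. -/
lemma exists_linearIsometryEquiv_hilbertTensor {σ τ H : Type*} [NormedAddCommGroup H]
    [InnerProductSpace ℝ H] [CompleteSpace H] {f : σ → E} {g : τ → F} {w : σ × τ → H}
    (hf : Orthonormal ℝ f) (hf' : Dense (Submodule.span ℝ (range f) : Set E))
    (hg : Orthonormal ℝ g) (hg' : Dense (Submodule.span ℝ (range g) : Set F))
    (hw : Orthonormal ℝ w) (hw' : (Submodule.span ℝ (range w))ᗮ = ⊥) :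
    ∃ Φ : HilbertTensor E F ≃ₗᵢ[ℝ] H, ∀ j k, Φ (pureTensor (f j) (g k)) = w (j, k) := by
  obtain ⟨Φ, hΦ⟩ := exists_linearIsometryEquiv_of_orthonormal (orthonormal_pureTensor hf hg)
    (orthogonal_span_pureTensor_eq_bot hf' hg') hw hw'
  exact ⟨Φ, fun j k => hΦ (j, k)⟩

end HilbertTensor

section Normalized

variable [Nonempty ι] {lam : ℕ → ℝ} {e : ℕ → H01 Ω}

/-- The functions `λⱼ^(-1/2) eⱼ` are orthonormal in `H₀¹(Ω)`. -/
lemma IsDirichletEigensystem.orthonormal_normalized (h : IsDirichletEigensystem Ω lam e) :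
    Orthonormal ℝ fun j => (√(lam j))⁻¹ • e j := by
  rw [orthonormal_iff_ite]
  intro j k
  rw [real_inner_smul_left, real_inner_smul_right, inner_eq_of_eigenpair (h.eigenpair j),
    ← l2Inner_eq, h.orthonormal]
  split_ifs with hjk
  · subst hjk
    have hs := Real.mul_self_sqrt (h.lam_pos j).le
    have : √(lam j) ≠ 0 := (Real.sqrt_pos.2 (h.lam_pos j)).ne'
    field_simp
    nlinarith
  · ring

lemma IsDirichletEigensystem.dense_span_normalized (h : IsDirichletEigensystem Ω lam e) :
    Dense (Submodule.span ℝ (range fun j => (√(lam j))⁻¹ • e j) : Set (H01 Ω)) := by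
  refine h.dense_span.mono (Submodule.span_le.2 ?_)
  rintro _ ⟨j, rfl⟩
  have : e j = √(lam j) • ((√(lam j))⁻¹ • e j) :=
    (smul_inv_smul₀ (Real.sqrt_pos.2 (h.lam_pos j)).ne' _).symm
  rw [this]
  exact Submodule.smul_mem _ _ (Submodule.subset_span ⟨j, rfl⟩)

end Normalized

end ProductDirichlet

end

theorem corollary3p3 {N₁ N₂ : ℕ} [NeZero N₁] [NeZero N₂]
    (Ω₁ : Domain (Fin N₁)) (Ω₂ : Domain (Fin N₂))
    (lam₁ lam₂ : ℕ → ℝ) (e₁ : ℕ → H01 Ω₁) (e₂ : ℕ → H01 Ω₂)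
    (h₁ : IsDirichletEigensystem Ω₁ lam₁ e₁) (h₂ : IsDirichletEigensystem Ω₂ lam₂ e₂) :
    (∀ μ : ℝ, IsDirichletEigenvalue (Ω₁.prod Ω₂) μ ↔ ∃ j k, μ = lam₁ j + lam₂ k) ∧
    (∀ (u : H01 Ω₁) (v : H01 Ω₂), ∃ w : H01 (Ω₁.prod Ω₂), IsDyad u v w) ∧
    Dense (Submodule.span ℝ {w : H01 (Ω₁.prod Ω₂) | ∃ u v, IsDyad u v w} :
      Set (H01 (Ω₁.prod Ω₂))) ∧
    ∃ Φ : HilbertTensor (H01 Ω₁) (H01 Ω₂) ≃ₗᵢ[ℝ] H01 (Ω₁.prod Ω₂),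
      ∀ (j k : ℕ) (w : H01 (Ω₁.prod Ω₂)), IsDyad (e₁ j) (e₂ k) w →
        Φ (pureTensor ((√(lam₁ j))⁻¹ • e₁ j) ((√(lam₂ k))⁻¹ • e₂ k)) =
          (√(lam₁ j + lam₂ k))⁻¹ • w := by
  refine ⟨isDirichletEigenvalue_prod_iff h₁ h₂, fun u v => ⟨H01.tensor u v, H01.isDyad_iff.2 rfl⟩,
    dense_span_dyads h₁ h₂, ?_⟩
  obtain ⟨Φ, hΦ⟩ := exists_linearIsometryEquiv_hilbertTensor
    h₁.orthonormal_normalized h₁.dense_span_normalized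
    h₂.orthonormal_normalized h₂.dense_span_normalized
    (orthonormal_tensor h₁ h₂) (orthogonal_span_tensor_eq_bot h₁ h₂)
  refine ⟨Φ, fun j k w hw => ?_⟩
  rw [H01.isDyad_iff.1 hw]
  exact hΦ j k
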